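/- Fix $\theta\in[0,\infty]$, $\lambda>0$ and a probability distribution $G$ on $(0,\infty)$ with finite mean. Messages arrive at a two-cell buffer according to a Poisson process of rate $\lambda$ on $\mathbb R$, with i.i.d. service times of law $G$, independent of the arrivals. Cell 1 holds the message in service (served at unit rate), cell 2 a waiting message. Let $\mathfrak u(t)$ be the amount of service received up to time $t$ by the message in cell 1 ($0$ if the system is empty). A message arriving at time $t$ takes cell 1, pushing out the message there (if any), when $\mathfrak u(t)\le\theta$; otherwise it takes cell 2, pushing out the message there (if any). When a service is completed, the message departs and the waiting message, if any, moves to cell 1. The system is causal and in steady state. Let $\cdots<S_{-1}<S_0\le 0<S_1<\cdots$ be the epochs of (successful) departures, $K_n$ the number of messages in the system immediately after $S_n$, $\alpha(t)=t-A(t)$ with $A(t)$ the maximal arrival time of the messages completely served by time $t$, and $\mathbb E^0$ the expectation under the Palm probability of the departure process (i.e. given $S_0=0$). Let $\hat G(s)=\int e^{-sx}\,dG(x)$, $\hat F_0(s)=\hat G(s+\lambda)/\hat G(\lambda)$, let $1-q=\mathbb P(\tau>\theta\wedge\sigma)$ for independent $\tau\sim\exp(\lambda)$ and $\sigma\sim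 G$, and let $\hat J(s)=\int_{[0,\theta)}e^{-sy}\,q^{-1}\lambda e^{-\lambda y}(1-G(y))\,dy$ (when $\theta=0$ one has $q=0$, and $q\hat J(s)$ is read as $0$). Then for every real $s\ge 0$, $$\mathbb E^0\big(e^{-s(S_0-S_{-1})}\mid K_{-1}=0,K_0=0\big)=\frac{\lambda}{\lambda+s}\cdot\frac{1-q}{1-q\hat J(s)}\,\hat F_0(s),$$ $$\mathbb E^0\big(e^{-s\alpha(S_0)}\mid K_{-1}=0,K_0=0\big)=\hat F_0(s).$$ -/

import Mathlib

open MeasureTheory ProbabilityTheory Filter Set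
open scoped ENNReal

noncomputable section

namespace AoI

/-! ## The buffer and its dynamics -/

/-- Contents of the two-cell buffer. Messages are labelled by integers (message `n` is the `n`-th
arrival); `cell₁` is the message in service, `cell₂` the waiting message, and `u` is the amount
of service received so far by the message in cell 1 (`0` if there is none). -/
structure Buffer where
  cell₁ : Option ℤ
  cell₂ : Option ℤ
  u : ℝ

/-- The empty buffer. -/
def Buffer.empty : Buffer := ⟨none, none, 0⟩

/-- Number of messages in the system. -/
def Buffer.count (b : Buffer) : ℕ :=
  (if b.cell₁.isSome then 1 else 0) + (if b.cell₂.isSome then 1 else 0)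

/-- Renumbering of the messages: message `i` becomes message `i - k`. -/
def Buffer.relabel (k : ℤ) (b : Buffer) : Buffer :=
  ⟨b.cell₁.map (fun i => i - k), b.cell₂.map (fun i => i - k), b.u⟩

/-- Effect of the arrival of message `n`: if the service received so far by the message in cell 1
is at most `θ`, then message `n` takes cell 1, pushing out the message there, if any (an empty
system has `u = 0`); otherwise message `n` takes cell 2, pushing out the message there, if any. -/
def Buffer.arrive (θ : ℝ≥0∞) (n : ℤ) (b : Buffer) : Buffer :=
  if ENNReal.ofReal b.u ≤ θ then ⟨some n, b.cell₂, 0⟩ else ⟨b.cell₁, some n, b.u⟩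

/-- Evolution over `h ≥ 0` units of time without arrivals, where `σ i` is the service time of
message `i`: the message in cell 1 is served at unit rate and leaves when its service is complete;
then the waiting message, if any, moves to cell 1 and is served. -/
def Buffer.serve (σ : ℤ → ℝ) (h : ℝ) (b : Buffer) : Buffer :=
  match b.cell₁ with
  | none => Buffer.empty
  | some i =>
    if b.u + h < σ i then ⟨some i, b.cell₂, b.u + h⟩
    else
      match b.cell₂ with
      | none => Buffer.empty
      | some j =>
        if b.u + h - σ i < σ j then ⟨some j, none, b.u + h - σ i⟩ else Buffer.empty

/-- `X : ℝ → Buffer` is a (right-continuous, bi-infinite) trajectory of the system `P_{2,θ}` with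
arrival times `T n` and service times `σ n`. -/
structure IsTrajectory (θ : ℝ≥0∞) (T σ : ℤ → ℝ) (X : ℝ → Buffer) : Prop where
  /-- between consecutive arrivals -/
  serve : ∀ n, ∀ t ∈ Ico (T n) (T (n + 1)), X t = (X (T n)).serve σ (t - T n)
  /-- at an arrival -/
  arrive : ∀ n, X (T (n + 1)) =
    (((X (T n)).serve σ (T (n + 1) - T n))).arrive θ (n + 1)
  /-- only messages that have already arrived are in the buffer -/
  arrived₁ : ∀ t i, (X t).cell₁ = some i → T i ≤ t
  arrived₂ : ∀ t i, (X t).cell₂ = some i → T i ≤ t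

/-- Message `i` departs (successfully) at time `t`: it is in service just before `t`, and at time
`t` the amount of service that it has received reaches its service time `σ i`. -/
def DepartsAt (σ : ℤ → ℝ) (X : ℝ → Buffer) (i : ℤ) (t : ℝ) : Prop :=
  ∃ a < t, ∀ r ∈ Ico a t, (X r).cell₁ = some i ∧ (X r).u = σ i - (t - r)

/-- `A(t)`: the maximal arrival time of the messages completely served by time `t`. -/
def lastServedArrival (T σ : ℤ → ℝ) (X : ℝ → Buffer) (t : ℝ) : ℝ :=
  sSup {a | ∃ i d, DepartsAt σ X i d ∧ d ≤ t ∧ a = T i}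

/-- The age of information `α(t) = t - A(t)`. -/
def age (T σ : ℤ → ℝ) (X : ℝ → Buffer) (t : ℝ) : ℝ :=
  t - lastServedArrival T σ X t

/-! ## The stationary system -/

/-- For arrival times `⋯ < T 0 ≤ 0 < T 1 < ⋯`, the lengths of the intervals into which the line
is cut by the arrivals and by the origin: `T 1`, `T 2 - T 1`, `…` for `n = 1, 2, …`, and
`-T 0`, `T 0 - T (-1)`, `…` for `n = 0, -1, …`. -/
def spacing (T : ℤ → ℝ) (n : ℤ) : ℝ :=
  if 1 ≤ n then T n - max (T (n - 1)) 0 else min (T (n + 1)) 0 - T n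

/-- The system `P_{2,θ}` in steady state, on a probability space `(Ω, P)` with a measurable,
measure preserving flow of time shifts: Poisson arrivals of rate `lam`, i.i.d. service times with
law `G`, independent of the arrivals. -/
structure StationarySystem {Ω : Type*} [MeasurableSpace Ω] (P : Measure Ω)
    (lam : ℝ) (G : Measure ℝ) (θ : ℝ≥0∞) where
  /-- time shifts: `shift t ω` is `ω` seen from time `t` -/
  shift : ℝ → Ω → Ω
  shift_zero : ∀ ω, shift 0 ω = ω
  shift_add : ∀ t r ω, shift (t + r) ω = shift r (shift t ω)
  measurable_shift : Measurable (fun p : ℝ × Ω => shift p.1 p.2)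
  map_shift : ∀ t, P.map (shift t) = P
  /-- arrival times -/
  T : ℤ → Ω → ℝ
  /-- service times -/
  σ : ℤ → Ω → ℝ
  /-- contents of the buffer -/
  X : Ω → ℝ → Buffer
  /-- successful departure epochs -/
  S : ℤ → Ω → ℝ
  measurable_T : ∀ n, Measurable (T n)
  measurable_σ : ∀ n, Measurable (σ n)
  measurable_u : Measurable (fun ω => (X ω 0).u)
  measurable_cell₁ : ∀ c, MeasurableSet {ω | (X ω 0).cell₁ = c}
  measurable_cell₂ : ∀ c, MeasurableSet {ω | (X ω 0).cell₂ = c}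
  measurable_S : ∀ n, Measurable (S n)
  strictMono_T : ∀ ω, StrictMono (fun n => T n ω)
  T_atTop : ∀ ω, Tendsto (fun n => T n ω) atTop atTop
  T_atBot : ∀ ω, Tendsto (fun n => T n ω) atBot atBot
  T_origin : ∀ ω, T 0 ω ≤ 0 ∧ 0 < T 1 ω
  /-- the arrivals form a Poisson process on the line, the service times are i.i.d. marks -/
  iIndep : iIndepFun (fun (n : ℤ) (ω : Ω) => (spacing (fun m => T m ω) n, σ n ω)) P
  law : ∀ n : ℤ, P.map (fun ω => (spacing (fun m => T m ω) n, σ n ω)) = (expMeasure lam).prod G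
  /-- the contents of the buffer follow the rules of `P_{2,θ}` -/
  trajectory : ∀ ω, IsTrajectory θ (fun n => T n ω) (fun n => σ n ω) (X ω)
  /-- the system is stationary: the arrivals, the service times and the contents of the buffer
  are shifted by the flow, up to the numbering of the messages -/
  covariant : ∀ t ω, ∃ k : ℤ,
    (∀ n, T n (shift t ω) = T (n + k) ω - t) ∧
    (∀ n, σ n (shift t ω) = σ (n + k) ω) ∧
    (∀ r, X (shift t ω) r = (X ω (r + t)).relabel k)
  /-- the system is causal: what happened up to time `0` (hence, by stationarity, up to any
  time) is independent of the later arrivals and their service times -/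
  causal : Indep
    ((⨆ n : {n : ℤ // n ≤ 0}, (MeasurableSpace.comap (T n) inferInstance ⊔
        MeasurableSpace.comap (σ n) inferInstance)) ⊔
      MeasurableSpace.comap (fun ω => (X ω 0).u) inferInstance ⊔
      MeasurableSpace.comap (fun ω => (X ω 0).cell₁) ⊤ ⊔
      MeasurableSpace.comap (fun ω => (X ω 0).cell₂) ⊤)
    (⨆ n : {n : ℤ // 1 ≤ n}, (MeasurableSpace.comap (T n) inferInstance ⊔
        MeasurableSpace.comap (σ n) inferInstance)) P
  /-- `⋯ < S 0 ≤ 0 < S 1 < ⋯` are the epochs of successful departures -/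
  strictMono_S : ∀ ω, StrictMono (fun n => S n ω)
  S_origin : ∀ ω, S 0 ω ≤ 0 ∧ 0 < S 1 ω
  range_S : ∀ ω, range (fun n => S n ω) = {t | ∃ i, DepartsAt (fun n => σ n ω) (X ω) i t}

namespace StationarySystem

variable {Ω : Type*} [MeasurableSpace Ω] {P : Measure Ω} {lam : ℝ} {G : Measure ℝ} {θ : ℝ≥0∞}

/-- `K_n`: the number of messages in the system immediately after the departure epoch `S_n`. -/
def K (Q : StationarySystem P lam G θ) (n : ℤ) (ω : Ω) : ℕ := (Q.X ω (Q.S n ω)).count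

/-- The age of information `α(t)`. -/
def α (Q : StationarySystem P lam G θ) (ω : Ω) (t : ℝ) : ℝ :=
  age (fun n => Q.T n ω) (fun n => Q.σ n ω) (Q.X ω) t

/-- The departure rate: the expected number of departures in `(0, 1]`. -/
def departureRate (Q : StationarySystem P lam G θ) : ℝ≥0∞ :=
  ∑' n : ℤ, P {ω | Q.S n ω ∈ Ioc (0 : ℝ) 1}

/-- The Palm probability `P⁰` of the departure process ("given `S_0 = 0`"):
`P⁰(B)` is the expected number of departures `S_n ∈ (0, 1]` such that the configuration seen from
time `S_n` is in `B`, divided by the departure rate. -/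
def palm (Q : StationarySystem P lam G θ) : Measure Ω :=
  (Q.departureRate)⁻¹ • Measure.sum (fun n : ℤ =>
    (P.restrict {ω | Q.S n ω ∈ Ioc (0 : ℝ) 1}).map (fun ω => Q.shift (Q.S n ω) ω))

/-- `P⁰` conditioned on `K_{-1} = i` and `K_0 = j`. -/
def palmCond (Q : StationarySystem P lam G θ) (i j : ℕ) : Measure Ω :=
  ProbabilityTheory.cond Q.palm {ω | Q.K (-1) ω = i ∧ Q.K 0 ω = j}

end StationarySystem

/-! ## The quantities in the formulas -/

/-- Laplace transform of a measure on the line. -/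
def laplace (ν : Measure ℝ) (s : ℝ) : ℝ := ∫ x, Real.exp (-(s * x)) ∂ν

/-- `q`, where `1 - q = P(τ > θ ∧ σ)` for independent `τ ~ exp(lam)` and `σ ~ G`. -/
def qProb (lam : ℝ) (G : Measure ℝ) (θ : ℝ≥0∞) : ℝ :=
  1 - ((expMeasure lam).prod G).real {p | min θ (ENNReal.ofReal p.2) < ENNReal.ofReal p.1}

/-- The law `dJ(y) = q⁻¹ lam e^{-lam y} (1 - G(y)) dy` on `0 ≤ y < θ`. -/
def lawJ (lam : ℝ) (G : Measure ℝ) (θ : ℝ≥0∞) : Measure ℝ :=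
  (volume.restrict {y : ℝ | 0 ≤ y ∧ ENNReal.ofReal y < θ}).withDensity (fun y =>
    ENNReal.ofReal ((qProb lam G θ)⁻¹ * lam * Real.exp (-(lam * y)) * (1 - cdf G y)))

/-- `F̂₀(s) = Ĝ(s + lam) / Ĝ(lam)`. -/
def F₀hat (lam : ℝ) (G : Measure ℝ) (s : ℝ) : ℝ := laplace G (s + lam) / laplace G lam

end AoI

end

/-!
The proof computes the two transforms from the behaviour of the stationary system at time `0`, by
Palm inversion, so that no strong Markov property at the departure epochs is needed.

Call a cycle the interval between two consecutive departures that both leave the system empty. Its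
structure is pathwise (`IsRegularTrajectory.exists_succeedsAt_of_empty` and
`IsRegularTrajectory.first_departure_of_succeedsAt`): the system stays idle for a time `I`, then a
message arrives, and each message is pushed out by the next arrival until one of them is served
before the next arrival; had a message been admitted to the waiting cell, the departure would leave
it behind. The departing message is the most recent one, so the age at the departure is its service
time.

Let `M` be the unnormalised Palm measure of the departures (`StationarySystem.departureMeasure`), and
let `W` be a weight that depends on what happens in the cycle after its idle period only. Palm
inversion (`StationarySystem.palm_inversion`) turns the integral over a cycle, under `M`, of an
observable of the shifted configuration into its expectation under `P`. It is applied to the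
observable that requires the system to be idle at time `0`, and that weights the residual idle time
`t` by `c e^{-c t}` and the current cycle by `W`. Over an idle period of length `I` this weight
integrates to `1 - e^{-c I}`. At the fixed time `0`, on the other hand, causality makes the idle event
independent of the later arrivals, so the expectation of the observable is
`P(idle) * (c lam / (lam + c)) * E W`, where `E W` is the sum of a geometric series over the number of
messages pushed out (`StationarySystem.lintegral_idle_mul`). Hence
`M((1 - e^{-c I}) W) = P(idle) * (c lam / (lam + c)) * E W`. Letting `c` tend to infinity gives
`M(W) = lam P(idle) E W`, and then, by subtraction, `M(e^{-c I} W) = lam / (lam + c) * M(W)`: the idle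
period is exponential and independent of the rest of the cycle.

The conditional Palm expectations are quotients of such integrals. For these to make sense, the
departure rate has to be finite (`StationarySystem.departureRate_ne_top`: the buffer holds two
messages at most, so three departures take at least one arrival) and the system has to be idle with
positive probability (`StationarySystem.idle_ne_zero`: with positive probability nobody arrives until
the work present is done).
-/

namespace AoI

/-! ### The buffer between and at arrivals -/

lemma Buffer.serve_serve (σ : ℤ → ℝ) {h h' : ℝ} (hh' : 0 ≤ h') (b : Buffer) :
    (b.serve σ h).serve σ h' = b.serve σ (h + h') := by
  obtain ⟨c₁, c₂, u⟩ := b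
  rcases c₁ with _ | i <;> rcases c₂ with _ | j
  · simp [Buffer.serve, Buffer.empty]
  · simp [Buffer.serve, Buffer.empty]
  · by_cases h1 : u + h < σ i
    · simp [Buffer.serve, Buffer.empty, h1, add_assoc]
    · have : ¬ (u + (h + h') < σ i) := by linarith
      simp [Buffer.serve, Buffer.empty, h1, this]
  · by_cases h1 : u + h < σ i
    · simp [Buffer.serve, Buffer.empty, h1, add_assoc]
    · have h2 : ¬ (u + (h + h') < σ i) := by linarith
      by_cases h3 : u + h - σ i < σ j
      · have h4 : u + h - σ i + h' = u + (h + h') - σ i := by ring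
        simp [Buffer.serve, Buffer.empty, h1, h2, h3, h4]
      · have : ¬ (u + (h + h') - σ i < σ j) := by linarith
        simp [Buffer.serve, Buffer.empty, h1, h2, h3, this]

lemma Buffer.serve_of_cell₁_none (σ : ℤ → ℝ) (h : ℝ) {b : Buffer} (hb : b.cell₁ = none) :
    b.serve σ h = Buffer.empty := by
  simp [Buffer.serve, hb]

lemma Buffer.serve_of_lt {σ : ℤ → ℝ} {h : ℝ} {b : Buffer} {i : ℤ} (hb : b.cell₁ = some i)
    (hu : b.u + h < σ i) : b.serve σ h = ⟨some i, b.cell₂, b.u + h⟩ := by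
  simp [Buffer.serve, hb, hu]

lemma Buffer.serve_eq_empty {σ : ℤ → ℝ} {h : ℝ} {b : Buffer}
    (hb : (b.serve σ h).cell₁ = none) : b.serve σ h = Buffer.empty := by
  obtain ⟨c₁, c₂, u⟩ := b
  unfold Buffer.serve Buffer.empty at *
  rcases c₁ with _ | k <;> rcases c₂ with _ | j <;> simp at *
  all_goals (split_ifs at *; simp_all)

lemma Buffer.serve_u_lt {σ : ℤ → ℝ} {h : ℝ} {b : Buffer} {i : ℤ}
    (hb : (b.serve σ h).cell₁ = some i) : (b.serve σ h).u < σ i := by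
  obtain ⟨c₁, c₂, u⟩ := b
  unfold Buffer.serve Buffer.empty at *
  rcases c₁ with _ | k <;> rcases c₂ with _ | j <;> simp at *
  all_goals split_ifs at * <;> simp_all

lemma Buffer.serve_of_le {σ : ℤ → ℝ} {h : ℝ} {b : Buffer} {i : ℤ} (hb : b.cell₁ = some i)
    (hb₂ : b.cell₂ = none) (hu : σ i ≤ b.u + h) : b.serve σ h = Buffer.empty := by
  simp [Buffer.serve, hb, hb₂, not_lt.2 hu]

lemma Buffer.count_serve_le (σ : ℤ → ℝ) (h : ℝ) (b : Buffer) :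
    (b.serve σ h).count ≤ b.count := by
  obtain ⟨c₁, c₂, u⟩ := b
  unfold Buffer.serve Buffer.empty Buffer.count
  rcases c₁ with _ | k <;> rcases c₂ with _ | j <;> simp
  all_goals split_ifs <;> simp_all

/-- Completing a service without an arrival lowers the number of messages. -/
lemma Buffer.count_serve_lt {σ : ℤ → ℝ} {h : ℝ} {b : Buffer} {i : ℤ} (hb : b.cell₁ = some i)
    (hu : σ i ≤ b.u + h) : (b.serve σ h).count < b.count := by
  obtain ⟨c₁, c₂, u⟩ := b
  unfold Buffer.serve Buffer.empty Buffer.count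
  simp at hb hu
  subst hb
  rcases c₂ with _ | j <;> simp [not_lt.2 hu]
  all_goals split_ifs <;> simp_all

lemma Buffer.count_le_two (b : Buffer) : b.count ≤ 2 := by
  unfold Buffer.count
  split_ifs <;> simp

section Trajectory

variable {θ : ℝ≥0∞} {T σ : ℤ → ℝ} {X : ℝ → Buffer}

/-- Every time lies in a unique interval between consecutive arrivals. -/
lemma exists_mem_Ico_arrivals {T : ℤ → ℝ} (hT : StrictMono T) (h₁ : Tendsto T atTop atTop)
    (h₂ : Tendsto T atBot atBot) (t : ℝ) : ∃ n, T n ≤ t ∧ t < T (n + 1) := by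
  obtain ⟨a, ha⟩ := (h₂.eventually (eventually_le_atBot t)).exists
  obtain ⟨b, hb⟩ := (h₁.eventually (eventually_gt_atTop t)).exists
  obtain ⟨n, hn, hmax⟩ := Int.exists_greatest_of_bdd (P := fun n => T n ≤ t)
    ⟨b, fun z hz => (hT.lt_iff_lt.1 (lt_of_le_of_lt hz hb)).le⟩ ⟨a, ha⟩
  refine ⟨n, hn, ?_⟩
  by_contra h
  have := hmax (n + 1) (not_lt.1 h)
  omega

/-- A trajectory together with the regularity of the data: the arrival times are enumerated
increasingly without accumulation point, and the service times are positive. -/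
structure IsRegularTrajectory (θ : ℝ≥0∞) (T σ : ℤ → ℝ) (X : ℝ → Buffer) : Prop where
  traj : IsTrajectory θ T σ X
  strictMono : StrictMono T
  atTop : Tendsto T atTop atTop
  atBot : Tendsto T atBot atBot
  pos : ∀ i, 0 < σ i

namespace IsRegularTrajectory

variable (h : IsRegularTrajectory θ T σ X)
include h

lemma exists_mem_Ico (t : ℝ) : ∃ n, T n ≤ t ∧ t < T (n + 1) :=
  exists_mem_Ico_arrivals h.strictMono h.atTop h.atBot t

lemma eq_serve_of_mem {n : ℤ} {t t' : ℝ} (h₁ : T n ≤ t) (h₂ : t ≤ t') (h₃ : t' < T (n + 1)) :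
    X t' = (X t).serve σ (t' - t) := by
  rw [h.traj.serve n t ⟨h₁, by linarith⟩, h.traj.serve n t' ⟨by linarith, h₃⟩,
    Buffer.serve_serve _ (by linarith)]
  congr 1; ring

/-- Without arrivals in `(t, t']`, the buffer is only served. -/
lemma eq_serve {t t' : ℝ} (h₂ : t ≤ t') (hno : ∀ n, ¬ (t < T n ∧ T n ≤ t')) :
    X t' = (X t).serve σ (t' - t) := by
  obtain ⟨n, hn, hn'⟩ := h.exists_mem_Ico t
  refine h.eq_serve_of_mem hn h₂ ?_
  by_contra hc
  exact hno (n + 1) ⟨hn', not_lt.1 hc⟩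

lemma eq_empty {t : ℝ} (ht : (X t).cell₁ = none) : X t = Buffer.empty := by
  obtain ⟨n, hn, hn'⟩ := h.exists_mem_Ico t
  rw [h.traj.serve n t ⟨hn, hn'⟩] at ht ⊢
  exact Buffer.serve_eq_empty ht

lemma count_eq_zero_iff {t : ℝ} : (X t).count = 0 ↔ (X t).cell₁ = none := by
  constructor
  · intro h0
    unfold Buffer.count at h0
    rcases hc : (X t).cell₁ with _ | i
    · rfl
    · simp [hc] at h0
  · intro h0
    rw [h.eq_empty h0]
    simp [Buffer.count, Buffer.empty]

lemma u_lt {t : ℝ} {i : ℤ} (ht : (X t).cell₁ = some i) : (X t).u < σ i := by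
  obtain ⟨n, hn, hn'⟩ := h.exists_mem_Ico t
  rw [h.traj.serve n t ⟨hn, hn'⟩] at ht ⊢
  exact Buffer.serve_u_lt ht

lemma arrival_cell₁ (n : ℤ) : (X (T n)).cell₁ ≠ none := by
  have := h.traj.arrive (n - 1)
  rw [sub_add_cancel] at this
  rw [this]
  unfold Buffer.arrive
  split_ifs with h1
  · simp
  · intro h2
    apply h1
    rw [Buffer.serve_eq_empty h2]
    simp [Buffer.empty]

/-- The message in service departs when its remaining service time has elapsed, unless another
message arrives before. -/
lemma departsAt {r d : ℝ} {i : ℤ} (hr : (X r).cell₁ = some i) (hd : d = r + (σ i - (X r).u))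
    (hno : ∀ n, ¬ (r < T n ∧ T n < d)) : DepartsAt σ X i d := by
  have hu := h.u_lt hr
  refine ⟨r, by linarith, fun t ht => ?_⟩
  rw [h.eq_serve ht.1 (fun n hn => hno n ⟨hn.1, lt_of_le_of_lt hn.2 ht.2⟩),
    Buffer.serve_of_lt hr (by linarith [ht.2])]
  refine ⟨rfl, ?_⟩
  simp only
  linarith

/-- The last moments before a departure: a time `r < d`, as late as prescribed, after which no
message arrives before `d`. -/
lemma exists_before_departure {i : ℤ} {d a : ℝ} (hd : DepartsAt σ X i d) (ha : a < d) :
    ∃ r, a ≤ r ∧ r < d ∧ (X r).cell₁ = some i ∧ (X r).u = σ i - (d - r) ∧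
      ∀ n, ¬ (r < T n ∧ T n < d) := by
  obtain ⟨a', ha', hd⟩ := hd
  obtain ⟨n, hn, hn'⟩ : ∃ n, T n < d ∧ d ≤ T (n + 1) := by
    obtain ⟨n, hn, hn'⟩ := h.exists_mem_Ico d
    rcases hn.lt_or_eq with h1 | h1
    · exact ⟨n, h1, hn'.le⟩
    · exact ⟨n - 1, h1 ▸ h.strictMono (by omega), by simp [h1]⟩
  have hr : max (max a' a) (T n) < d := max_lt (max_lt ha' ha) hn
  have hr' := hd (max (max a' a) (T n)) ⟨(le_max_left _ _).trans (le_max_left _ _), hr⟩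
  refine ⟨max (max a' a) (T n), (le_max_right _ _).trans (le_max_left _ _), hr, hr'.1, hr'.2,
    fun m hm => ?_⟩
  have h1 : n < m := h.strictMono.lt_iff_lt.1 (lt_of_le_of_lt (le_max_right _ _) hm.1)
  have h2 : m < n + 1 := h.strictMono.lt_iff_lt.1 (lt_of_lt_of_le hm.2 hn')
  omega

/-- A message has arrived before it departs. -/
lemma arrival_lt_departure {i : ℤ} {d : ℝ} (hd : DepartsAt σ X i d) : T i < d := by
  obtain ⟨a, ha, hd⟩ := hd
  exact lt_of_le_of_lt (h.traj.arrived₁ a i (hd a ⟨le_rfl, ha⟩).1) ha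

/-- The system can only become empty by a departure. -/
lemma exists_departure_of_empty {t t' : ℝ} (htt : t ≤ t') (ht : (X t).cell₁ ≠ none)
    (ht' : (X t').cell₁ = none) : ∃ i d, DepartsAt σ X i d ∧ t < d ∧ d ≤ t' := by
  obtain ⟨n, hn, hn'⟩ := h.exists_mem_Ico t'
  obtain ⟨r, hr₁, hr₂, hr₃, hr⟩ : ∃ r, t ≤ r ∧ T n ≤ r ∧ r ≤ t' ∧ (X r).cell₁ ≠ none := by
    rcases le_total t (T n) with h1 | h1
    · exact ⟨T n, h1, le_rfl, hn, h.arrival_cell₁ n⟩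
    · exact ⟨t, le_rfl, h1, htt, ht⟩
  obtain ⟨i, hi⟩ := Option.ne_none_iff_exists'.1 hr
  have hu := h.u_lt hi
  have hle : r + (σ i - (X r).u) ≤ t' := by
    by_contra hc
    rw [h.eq_serve_of_mem hr₂ hr₃ hn', Buffer.serve_of_lt hi (by linarith)] at ht'
    simp at ht'
  refine ⟨i, _, h.departsAt hi rfl fun m hm => ?_, by linarith, hle⟩
  have h1 : n < m := h.strictMono.lt_iff_lt.1 (lt_of_le_of_lt hr₂ hm.1)
  have h2 : m < n + 1 := h.strictMono.lt_iff_lt.1 (by linarith)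
  omega

lemma empty_of_empty {t t' : ℝ} (htt : t ≤ t') (ht : (X t).cell₁ = none)
    (hno : ∀ n, ¬ (t < T n ∧ T n ≤ t')) : (X t').cell₁ = none := by
  rw [h.eq_serve htt hno, Buffer.serve_of_cell₁_none _ _ ht]
  rfl

/-- Without arrivals, every departure lowers the number of messages. -/
lemma count_lt_of_departs {i : ℤ} {t d : ℝ} (hd : DepartsAt σ X i d) (htd : t < d)
    (hno : ∀ n, ¬ (t < T n ∧ T n ≤ d)) : (X d).count < (X t).count := by
  obtain ⟨r, hr, hrd, hi, hu, -⟩ := h.exists_before_departure hd htd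
  calc (X d).count < (X r).count := by
        rw [h.eq_serve hrd.le (fun n hn => hno n ⟨by linarith [hn.1], hn.2⟩)]
        exact Buffer.count_serve_lt hi (by linarith)
    _ ≤ (X t).count := by
        rw [h.eq_serve hr (fun n hn => hno n ⟨hn.1, by linarith [hn.2]⟩)]
        exact Buffer.count_serve_le _ _ _

/-- The buffer holds two messages at most, so three departures take at least one arrival. -/
lemma exists_arrival_of_three_departures {t d₁ d₂ d₃ : ℝ} {i₁ i₂ i₃ : ℤ}
    (h₁ : DepartsAt σ X i₁ d₁) (h₂ : DepartsAt σ X i₂ d₂) (h₃ : DepartsAt σ X i₃ d₃)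
    (ht : t < d₁) (h₁₂ : d₁ < d₂) (h₂₃ : d₂ < d₃) : ∃ n, t < T n ∧ T n ≤ d₃ := by
  by_contra! hc
  have e₁ := h.count_lt_of_departs h₁ ht fun n hn => by linarith [hc n hn.1]
  have e₂ := h.count_lt_of_departs h₂ h₁₂ fun n hn => by linarith [hc n (by linarith [hn.1])]
  have e₃ := h.count_lt_of_departs h₃ h₂₃ fun n hn => by linarith [hc n (by linarith [hn.1])]
  have := (X t).count_le_two
  omega

end IsRegularTrajectory

end Trajectory

/-! ### The first departure after an idle instant -/

section FirstDeparture

variable {θ : ℝ≥0∞} {T σ : ℤ → ℝ} {X : ℝ → Buffer}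

/-- Message `j`, if its service starts on arrival, is pushed out by the next arrival. -/
def Replaced (θ : ℝ≥0∞) (T σ : ℤ → ℝ) (j : ℤ) : Prop :=
  ENNReal.ofReal (T (j + 1) - T j) ≤ θ ∧ T (j + 1) - T j < σ j

/-- Messages `1, …, l` are pushed out in turn, and message `l + 1` is served completely before the
next arrival. -/
def SucceedsAt (θ : ℝ≥0∞) (T σ : ℤ → ℝ) (l : ℕ) : Prop :=
  (∀ j : ℕ, j < l → Replaced θ T σ (j + 1)) ∧ σ (l + 1) < T (l + 1 + 1) - T (l + 1)

/-- The attempt that succeeds is unique. -/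
lemma SucceedsAt.eq {l l' : ℕ} (h : SucceedsAt θ T σ l) (h' : SucceedsAt θ T σ l') : l = l' := by
  rcases lt_trichotomy l l' with hl | hl | hl
  · have := (h'.1 l hl).2
    have := h.2
    linarith
  · exact hl
  · have := (h.1 l' hl).2
    have := h'.2
    linarith

namespace IsRegularTrajectory

variable (h : IsRegularTrajectory θ T σ X)
include h

/-- The first message to arrive at an empty system starts service. -/
lemma first_arrival (h₀ : T 0 ≤ 0) (h₁ : 0 < T 1) (he : (X 0).cell₁ = none) :
    X (T 1) = ⟨some 1, none, 0⟩ := by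
  have h2 := h.traj.arrive 0
  have h3 := h.traj.serve 0 0 ⟨h₀, by simpa using h₁⟩
  have h4 : (X (T 0)).serve σ (T (0 + 1) - T 0) = Buffer.empty := by
    rw [← Buffer.serve_of_cell₁_none σ (T 1) he, h3, Buffer.serve_serve _ h₁.le]
    congr 1
    simp; ring
  rw [h4] at h2
  simpa [Buffer.arrive, Buffer.empty] using h2

lemma next_of_replaced {j : ℤ} (hj : X (T j) = ⟨some j, none, 0⟩) (hr : Replaced θ T σ j) :
    X (T (j + 1)) = ⟨some (j + 1), none, 0⟩ := by
  rw [h.traj.arrive j, hj, Buffer.serve_of_lt (i := j) rfl (by simpa using hr.2)]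
  simp [Buffer.arrive, hr.1]

/-- After `l` replacements in a row, message `l + 1` starts its service alone. -/
lemma after_replacements (h₀ : T 0 ≤ 0) (h₁ : 0 < T 1) (he : (X 0).cell₁ = none) (l : ℕ)
    (hl : ∀ j : ℕ, j < l → Replaced θ T σ (j + 1)) :
    X (T (l + 1)) = ⟨some (l + 1 : ℤ), none, 0⟩ := by
  induction l with
  | zero => simpa using h.first_arrival h₀ h₁ he
  | succ l ih =>
    have := h.next_of_replaced (ih fun j hj => hl j (by omega)) (hl l (by omega))
    simpa using this

/-- If attempt `l` succeeds, the first departure is that of message `l + 1`, and it leaves the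
system empty. -/
lemma first_departure_of_succeedsAt (h₀ : T 0 ≤ 0) (h₁ : 0 < T 1) (he : (X 0).cell₁ = none)
    {l : ℕ} (hl : SucceedsAt θ T σ l) {i : ℤ} {D : ℝ} (hD : DepartsAt σ X i D) (hD₀ : 0 < D)
    (hfirst : ∀ i' d, DepartsAt σ X i' d → 0 < d → D ≤ d) :
    D = T (l + 1) + σ (l + 1) ∧ (X D).cell₁ = none := by
  have hX := h.after_replacements h₀ h₁ he l hl.1
  have hsucc := hl.2
  have hpos := h.pos (l + 1)
  have hT1 : T 1 ≤ T (l + 1) := h.strictMono.monotone (by omega)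
  have hDle : D ≤ T (l + 1) + σ (l + 1) := by
    refine hfirst (l + 1) _ (h.departsAt (r := T (l + 1)) (by rw [hX]) (by rw [hX]; simp) ?_)
      (by linarith)
    intro n hn
    have e1 := h.strictMono.lt_iff_lt.1 hn.1
    have e2 : n < l + 1 + 1 := h.strictMono.lt_iff_lt.1 (by linarith [hn.2])
    omega
  have hDeq : D = T (l + 1) + σ (l + 1) := by
    obtain ⟨r, hr₀, hrD, hi, hu, hno⟩ := h.exists_before_departure hD hD₀
    obtain ⟨m, hm, hm'⟩ := h.exists_mem_Ico r
    have hm1 : 1 ≤ m := by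
      by_contra hc
      have : (X r).cell₁ = none := by
        refine h.empty_of_empty hr₀ he fun n hn => ?_
        have e1 : 0 < n := h.strictMono.lt_iff_lt.1 (by linarith [hn.1])
        have e2 : n < m + 1 := h.strictMono.lt_iff_lt.1 (by linarith [hn.2])
        omega
      simp [this] at hi
    have hml : m < l + 1 + 1 := h.strictMono.lt_iff_lt.1 (by linarith)
    obtain ⟨j, rfl⟩ : ∃ j : ℕ, m = j + 1 := ⟨(m - 1).toNat, by omega⟩
    have hXm := h.after_replacements h₀ h₁ he j fun j' hj' => hl.1 j' (by omega)
    have hlt : r - T (j + 1) < σ (j + 1) := by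
      rcases Nat.lt_or_ge j l with hj | hj
      · linarith [(hl.1 j hj).2]
      · obtain rfl : j = l := by omega
        linarith
    have hXr : X r = ⟨some (j + 1 : ℤ), none, r - T (j + 1)⟩ := by
      rw [h.eq_serve_of_mem le_rfl hm hm', hXm,
        Buffer.serve_of_lt (i := (j + 1 : ℤ)) rfl (by simpa using hlt)]
      simp
    rw [hXr] at hi hu
    simp only [Option.some.injEq] at hi hu
    subst hi
    have hd : D = T (j + 1) + σ (j + 1) := by linarith
    rcases Nat.lt_or_ge j l with hj | hj
    · exact absurd ⟨hm', by linarith [(hl.1 j hj).2]⟩ (hno (j + 1 + 1))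
    · obtain rfl : j = l := by omega
      exact hd
  refine ⟨hDeq, ?_⟩
  rw [h.eq_serve_of_mem le_rfl (by linarith : T (l + 1) ≤ D) (by linarith), hX,
    Buffer.serve_of_le (i := (l + 1 : ℤ)) rfl rfl (by simp; linarith)]
  rfl

/-- If the first departure after an idle instant leaves the system empty, then every message
before the departing one was pushed out, and the latter is the last arrival: a message admitted to
the waiting cell would still be present. -/
lemma exists_succeedsAt_of_empty (h₀ : T 0 ≤ 0) (h₁ : 0 < T 1) (he : (X 0).cell₁ = none)
    {i : ℤ} {D : ℝ} (hD : DepartsAt σ X i D) (hD₀ : 0 < D)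
    (hfirst : ∀ i' d, DepartsAt σ X i' d → 0 < d → D ≤ d) (hXD : (X D).cell₁ = none) :
    ∃ l, SucceedsAt θ T σ l := by
  obtain ⟨m, hm, hm'⟩ := h.exists_mem_Ico D
  have hmD : T m < D := lt_of_le_of_ne hm fun hc => h.arrival_cell₁ m (hc ▸ hXD)
  have hm1 : 1 ≤ m := by
    by_contra hc
    obtain ⟨r, hr₀, hrD, hi, -⟩ := h.exists_before_departure hD hD₀
    have : (X r).cell₁ = none := by
      refine h.empty_of_empty hr₀ he fun n hn => ?_
      have e1 : 0 < n := h.strictMono.lt_iff_lt.1 (by linarith [hn.1])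
      have e2 : n < m + 1 := h.strictMono.lt_iff_lt.1 (by linarith [hn.2])
      omega
    simp [this] at hi
  obtain ⟨l, rfl⟩ : ∃ l : ℕ, m = l + 1 := ⟨(m - 1).toNat, by omega⟩
  have hTpos : ∀ k : ℤ, 1 ≤ k → 0 < T k := fun k hk =>
    lt_of_lt_of_le h₁ (h.strictMono.monotone hk)
  -- an uninterrupted service that starts after time `0` is completed at time `D` or later
  have hservice : ∀ k n : ℤ, 1 ≤ k → k ≤ n → (X (T n)).cell₁ = some k →
      (X (T n)).u = T n - T k → T k + σ k ≤ T (n + 1) → D ≤ T k + σ k := by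
    intro k n hk hkn hc hu hle
    have hlt := h.u_lt hc
    refine hfirst k _ (h.departsAt hc (by rw [hu]; ring) fun p hp => ?_)
      (by linarith [hTpos k hk, h.pos k])
    have e1 := h.strictMono.lt_iff_lt.1 hp.1
    have e2 : p < n + 1 := h.strictMono.lt_iff_lt.1 (by linarith [hp.2])
    omega
  have key : ∀ j : ℕ, j ≤ l → ∀ j' : ℕ, j' < j → Replaced θ T σ (j' + 1) := by
    intro j
    induction j with
    | zero => intro _ j' hj'; omega
    | succ j ih =>
      intro hj j' hj'
      rcases Nat.lt_succ_iff_lt_or_eq.1 hj' with hlt | rfl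
      · exact ih (by omega) j' hlt
      have hX := h.after_replacements h₀ h₁ he j' (ih (by omega))
      have hnext : T (j' + 1 + 1) < D :=
        lt_of_le_of_lt (h.strictMono.monotone (by omega)) hmD
      have hτ : T (j' + 1 + 1) - T (j' + 1) < σ (j' + 1) := by
        by_contra hc
        have := hservice (j' + 1) (j' + 1) (by omega) le_rfl (by rw [hX]) (by rw [hX]; simp)
          (by linarith)
        linarith
      refine ⟨?_, hτ⟩
      by_contra hθ
      have blocked : ∀ n : ℤ, (j' + 1 + 1 : ℤ) ≤ n → T n < D →
          X (T n) = ⟨some (j' + 1 : ℤ), some n, T n - T (j' + 1)⟩ := by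
        intro n hn
        induction n, hn using Int.leInduction with
        | base =>
          intro _
          rw [h.traj.arrive, hX, Buffer.serve_of_lt (i := (j' + 1 : ℤ)) rfl (by simpa using hτ)]
          simp only [zero_add, Buffer.arrive, hθ, if_false]
        | succ n hn ihn =>
          intro hnD
          have hTn : T n < T (n + 1) := h.strictMono (by omega)
          have hXn := ihn (by linarith)
          have hlt : T (n + 1) < T (j' + 1) + σ (j' + 1) := by
            by_contra hc
            have := hservice (j' + 1) n (by omega) (by omega) (by rw [hXn]) (by rw [hXn])
              (by linarith)
            linarith
          rw [h.traj.arrive, hXn, Buffer.serve_of_lt (i := (j' + 1 : ℤ)) rfl (by simp; linarith)]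
          have hmono : T (j' + 1 + 1) ≤ T (n + 1) := h.strictMono.monotone (by omega)
          have : ¬ ENNReal.ofReal (T n - T (j' + 1) + (T (n + 1) - T n)) ≤ θ := fun hle =>
            hθ (le_trans (ENNReal.ofReal_le_ofReal (by linarith)) hle)
          simp only [Buffer.arrive, this, if_false]
          congr 1
          ring
      have hXl := blocked (l + 1) (by omega) hmD
      have hserve := h.eq_serve_of_mem le_rfl hm hm'
      have hle : T (j' + 1) + σ (j' + 1) ≤ D := by
        by_contra hc
        rw [hserve, hXl, Buffer.serve_of_lt (i := (j' + 1 : ℤ)) rfl (by simp; linarith)] at hXD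
        simp at hXD
      have hDeq : D = T (j' + 1) + σ (j' + 1) := le_antisymm
        (hservice (j' + 1) (l + 1) (by omega) (by omega) (by rw [hXl]) (by rw [hXl])
          (by linarith)) hle
      have e1 : T (l + 1) - T (j' + 1) + (D - T (l + 1)) = σ (j' + 1) := by linarith
      have hpos := h.pos (l + 1)
      rw [hserve, hXl] at hXD
      simp [Buffer.serve, e1, hpos] at hXD
  refine ⟨l, key l le_rfl, ?_⟩
  have hX := h.after_replacements h₀ h₁ he l (key l le_rfl)
  by_contra hc
  rw [h.eq_serve_of_mem le_rfl hm hm', hX,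
    Buffer.serve_of_lt (i := (l + 1 : ℤ)) rfl (by simp; linarith)] at hXD
  simp at hXD

end IsRegularTrajectory

end FirstDeparture

/-! ### Time shifts and the Palm inversion formula -/

/-- Two increasing enumerations by the integers of the same set differ by a renumbering. -/
lemma exists_eq_add_of_range_eq {u v : ℤ → ℝ} (hu : StrictMono u) (hv : StrictMono v)
    (huv : range u = range v) : ∃ k, ∀ n, u n = v (n + k) := by
  have h1 : ∀ n, ∃ m, v m = u n := fun n => by
    have : u n ∈ range v := huv ▸ mem_range_self n
    exact this
  choose f hf using h1
  have hmono : StrictMono f := fun a b hab => hv.lt_iff_lt.1 (by rw [hf, hf]; exact hu hab)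
  have hsucc : ∀ n, f (n + 1) = f n + 1 := by
    intro n
    have h2 : f n < f (n + 1) := hmono (by omega)
    obtain ⟨m, hm⟩ : v (f n + 1) ∈ range u := huv ▸ mem_range_self _
    have hm' : f m = f n + 1 := hv.injective (by rw [hf, hm])
    have h3 : n < m := hmono.lt_iff_lt.1 (by omega)
    have h4 : f (n + 1) ≤ f m := hmono.monotone (by omega)
    omega
  have hf0 : ∀ n, f n = n + f 0 := by
    intro n
    induction n using Int.induction_on with
    | zero => simp
    | succ n ih => rw [hsucc, ih]; ring
    | pred n ih =>
      have := hsucc (-(n : ℤ) - 1)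
      rw [sub_add_cancel] at this
      omega
  exact ⟨f 0, fun n => by rw [← hf0, hf]⟩

namespace StationarySystem

variable {Ω : Type*} [MeasurableSpace Ω] {P : Measure Ω} {lam : ℝ} {G : Measure ℝ} {θ : ℝ≥0∞}

/-- The unnormalised Palm measure of the departures: the expected number of departures in `(0, 1]`
from which the configuration is seen in a given set. -/
noncomputable def departureMeasure (Q : StationarySystem P lam G θ) : Measure Ω :=
  Measure.sum (fun n : ℤ =>
    (P.restrict {ω | Q.S n ω ∈ Ioc (0 : ℝ) 1}).map (fun ω => Q.shift (Q.S n ω) ω))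

variable (Q : StationarySystem P lam G θ)

lemma palm_eq : Q.palm = (Q.departureRate)⁻¹ • Q.departureMeasure := rfl

lemma isRegularTrajectory {ω : Ω} (hω : ∀ n, 0 < Q.σ n ω) :
    IsRegularTrajectory θ (fun n => Q.T n ω) (fun n => Q.σ n ω) (Q.X ω) :=
  ⟨Q.trajectory ω, Q.strictMono_T ω, Q.T_atTop ω, Q.T_atBot ω, hω⟩

lemma departsAt_S (n : ℤ) (ω : Ω) : ∃ i, DepartsAt (fun n => Q.σ n ω) (Q.X ω) i (Q.S n ω) := by
  have : Q.S n ω ∈ range (fun n => Q.S n ω) := mem_range_self n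
  rwa [Q.range_S] at this

lemma exists_S_eq {ω : Ω} {i : ℤ} {t : ℝ} (h : DepartsAt (fun n => Q.σ n ω) (Q.X ω) i t) :
    ∃ n, Q.S n ω = t := by
  have : t ∈ range (fun n => Q.S n ω) := by rw [Q.range_S]; exact ⟨i, h⟩
  exact this

lemma cell₁_shift_eq_none (t r : ℝ) (ω : Ω) :
    (Q.X (Q.shift t ω) r).cell₁ = none ↔ (Q.X ω (r + t)).cell₁ = none := by
  obtain ⟨k, -, -, hX⟩ := Q.covariant t ω
  simp [hX, Buffer.relabel]

lemma count_shift (t r : ℝ) (ω : Ω) :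
    (Q.X (Q.shift t ω) r).count = (Q.X ω (r + t)).count := by
  obtain ⟨k, -, -, hX⟩ := Q.covariant t ω
  simp [hX, Buffer.relabel, Buffer.count]

lemma pos_shift {ω : Ω} (hω : ∀ n, 0 < Q.σ n ω) (t : ℝ) (n : ℤ) : 0 < Q.σ n (Q.shift t ω) := by
  obtain ⟨k, -, hσ, -⟩ := Q.covariant t ω
  rw [hσ]; exact hω _

/-- The departure epochs are shifted by the flow, up to their numbering. -/
lemma exists_S_shift (t : ℝ) (ω : Ω) : ∃ k, ∀ n, Q.S n (Q.shift t ω) = Q.S (n + k) ω - t := by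
  obtain ⟨k, -, hσ, hX⟩ := Q.covariant t ω
  have hdep : ∀ i d, DepartsAt (fun n => Q.σ n (Q.shift t ω)) (Q.X (Q.shift t ω)) i d ↔
      DepartsAt (fun n => Q.σ n ω) (Q.X ω) (i + k) (d + t) := by
    intro i d
    have hcell : ∀ r, (Q.X (Q.shift t ω) r).cell₁ = some i ↔
        (Q.X ω (r + t)).cell₁ = some (i + k) := by
      intro r
      rw [hX]
      simp only [Buffer.relabel, Option.map_eq_some_iff]
      constructor
      · rintro ⟨a, ha, rfl⟩; simpa using ha
      · intro h; exact ⟨_, h, by ring⟩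
    have hu : ∀ r, (Q.X (Q.shift t ω) r).u = (Q.X ω (r + t)).u := fun r => by
      rw [hX]; rfl
    constructor
    · rintro ⟨a, ha, h⟩
      refine ⟨a + t, by linarith, fun r hr => ?_⟩
      have := h (r - t) ⟨by linarith [hr.1], by linarith [hr.2]⟩
      simp only [hcell, hu, hσ, sub_add_cancel] at this
      exact ⟨this.1, by rw [this.2]; ring⟩
    · rintro ⟨a, ha, h⟩
      refine ⟨a - t, by linarith, fun r hr => ?_⟩
      have := h (r + t) ⟨by linarith [hr.1], by linarith [hr.2]⟩
      simp only [hcell, hu, hσ]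
      exact ⟨this.1, by rw [this.2]; ring⟩
  obtain ⟨m, hm⟩ := exists_eq_add_of_range_eq (u := fun n => Q.S n (Q.shift t ω))
    (v := fun n => Q.S n ω - t) (Q.strictMono_S _)
    (fun a b hab => by simpa using Q.strictMono_S ω hab) (by
      ext x
      rw [Q.range_S]
      constructor
      · rintro ⟨i, hi⟩
        obtain ⟨n, hn⟩ := Q.exists_S_eq ((hdep i x).1 hi)
        exact ⟨n, by simp [hn]⟩
      · rintro ⟨n, rfl⟩
        obtain ⟨i, hi⟩ := Q.departsAt_S n ω
        exact ⟨i - k, (hdep _ _).2 (by simpa using hi)⟩)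
  exact ⟨m, hm⟩

lemma exists_K_shift (t : ℝ) (ω : Ω) : ∃ k, (∀ n, Q.S n (Q.shift t ω) = Q.S (n + k) ω - t) ∧
    ∀ n, Q.K n (Q.shift t ω) = Q.K (n + k) ω := by
  obtain ⟨k, hk⟩ := Q.exists_S_shift t ω
  refine ⟨k, hk, fun n => ?_⟩
  rw [K, K, count_shift, hk, sub_add_cancel]

/-- Seen from a time in `[S_{n-1}, S_n)`, the next departure is that at `S_n`. -/
lemma S_shift_of_mem {t : ℝ} {ω : Ω} {n : ℤ} (h₁ : Q.S (n - 1) ω ≤ t) (h₂ : t < Q.S n ω) :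
    (∀ m, Q.S m (Q.shift t ω) = Q.S (m + (n - 1)) ω - t) ∧
      ∀ m, Q.K m (Q.shift t ω) = Q.K (m + (n - 1)) ω := by
  obtain ⟨k, hk, hK⟩ := Q.exists_K_shift t ω
  have h0 := Q.S_origin (Q.shift t ω)
  rw [hk, hk, zero_add] at h0
  have e1 : k < n := (Q.strictMono_S ω).lt_iff_lt.1 (by linarith [h0.1])
  have e2 : n - 1 < 1 + k := (Q.strictMono_S ω).lt_iff_lt.1 (by linarith [h0.2])
  obtain rfl : k = n - 1 := by omega
  exact ⟨hk, hK⟩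

/-- The configuration seen from the departure epoch `S_n`. -/
lemma S_shift_S (n : ℤ) (ω : Ω) :
    (∀ m, Q.S m (Q.shift (Q.S n ω) ω) = Q.S (m + n) ω - Q.S n ω) ∧
      ∀ m, Q.K m (Q.shift (Q.S n ω) ω) = Q.K (m + n) ω := by
  have := Q.S_shift_of_mem (t := Q.S n ω) (ω := ω) (n := n + 1) (by simp)
    (Q.strictMono_S ω (by omega))
  simpa using this

@[fun_prop]
lemma measurable_shift_comp {β : Type*} [MeasurableSpace β] {f : β → ℝ} {g : β → Ω}
    (hf : Measurable f) (hg : Measurable g) : Measurable (fun b => Q.shift (f b) (g b)) :=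
  Q.measurable_shift.comp (hf.prodMk hg)

lemma measurable_shift_S (n : ℤ) : Measurable (fun ω => Q.shift (Q.S n ω) ω) :=
  Q.measurable_shift_comp (Q.measurable_S n) measurable_id

lemma measurableSet_cell₁_none : MeasurableSet {ω | (Q.X ω 0).cell₁ = none} := Q.measurable_cell₁ _

lemma measurable_K (n : ℤ) : Measurable (Q.K n) := by
  have h0 : Measurable (fun ω => (Q.X ω 0).count) := by
    have : (fun ω => (Q.X ω 0).count) = fun ω =>
        ({ω | (Q.X ω 0).cell₁ = none}ᶜ.indicator (fun _ => 1) ω : ℕ) +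
        ({ω | (Q.X ω 0).cell₂ = none}ᶜ.indicator (fun _ => 1) ω : ℕ) := by
      funext ω
      unfold Buffer.count
      rcases h1 : (Q.X ω 0).cell₁ with _ | i <;> rcases h2 : (Q.X ω 0).cell₂ with _ | j <;>
        simp [h1, h2]
    rw [this]
    exact (measurable_const.indicator (Q.measurable_cell₁ _).compl).add
      (measurable_const.indicator (Q.measurable_cell₂ _).compl)
  have h1 : Q.K n = fun ω => (Q.X (Q.shift (Q.S n ω) ω) 0).count := by
    funext ω
    rw [count_shift, zero_add]
    rfl
  rw [h1]
  exact h0.comp (Q.measurable_shift_S n)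

lemma measurableSet_S_mem (n : ℤ) : MeasurableSet {ω | Q.S n ω ∈ Ioc (0 : ℝ) 1} :=
  Q.measurable_S n measurableSet_Ioc

lemma lintegral_departureMeasure {F : Ω → ℝ≥0∞} (hF : Measurable F) :
    ∫⁻ ω, F ω ∂Q.departureMeasure = ∑' n : ℤ, ∫⁻ ω,
      (Ioc (0 : ℝ) 1).indicator 1 (Q.S n ω) * F (Q.shift (Q.S n ω) ω) ∂P := by
  rw [departureMeasure, lintegral_sum_measure]
  refine tsum_congr fun n => ?_
  rw [lintegral_map hF (Q.measurable_shift_S n),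
    ← lintegral_indicator (Q.measurableSet_S_mem n)]
  refine lintegral_congr fun ω => ?_
  by_cases h : Q.S n ω ∈ Ioc (0 : ℝ) 1
  · have h' : ω ∈ {ω | Q.S n ω ∈ Ioc (0 : ℝ) 1} := h
    rw [indicator_of_mem h', indicator_of_mem h, Pi.one_apply, one_mul]
  · have h' : ω ∉ {ω | Q.S n ω ∈ Ioc (0 : ℝ) 1} := h
    rw [indicator_of_notMem h', indicator_of_notMem h, zero_mul]

lemma departureMeasure_univ : Q.departureMeasure univ = Q.departureRate := by
  rw [departureMeasure, Measure.sum_apply _ MeasurableSet.univ, departureRate]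
  refine tsum_congr fun n => ?_
  rw [Measure.map_apply (Q.measurable_shift_S n)
    MeasurableSet.univ]
  simp

/-- A property that every configuration has when seen from any of its departures holds almost
everywhere for the Palm measure. -/
lemma ae_departureMeasure {p : Ω → Prop} (hp : MeasurableSet {ω | p ω})
    (h : ∀ᵐ ω ∂P, ∀ n, p (Q.shift (Q.S n ω) ω)) : ∀ᵐ ω ∂Q.departureMeasure, p ω := by
  rw [departureMeasure, Measure.ae_sum_iff' hp]
  intro n
  rw [ae_map_iff (Q.measurable_shift_S n).aemeasurable hp]
  exact ae_restrict_of_ae (h.mono fun ω hω => hω n)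

lemma ae_departureMeasure_S_zero : ∀ᵐ ω ∂Q.departureMeasure, Q.S 0 ω = 0 :=
  Q.ae_departureMeasure (Q.measurable_S 0 (measurableSet_singleton 0))
    (ae_of_all _ fun ω n => by rw [(Q.S_shift_S n ω).1]; simp)

/-- Palm inversion: integrating over the interval between the last two departures under the Palm
measure gives back the stationary law. -/
lemma palm_inversion [SFinite P] {g : Ω → ℝ≥0∞} (hg : Measurable g) :
    ∫⁻ ω, ∫⁻ t, (Ico (Q.S (-1) ω) (Q.S 0 ω)).indicator (fun t => g (Q.shift t ω)) t
      ∂volume ∂Q.departureMeasure = ∫⁻ ω, g ω ∂P := by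
  have hmeasI : ∀ n m : ℤ, Measurable (fun p : Ω × ℝ =>
      (Ico (Q.S n p.1) (Q.S m p.1)).indicator (fun t => g (Q.shift t p.1)) p.2) := by
    intro n m
    have hset : MeasurableSet {p : Ω × ℝ | Q.S n p.1 ≤ p.2 ∧ p.2 < Q.S m p.1} :=
      (measurableSet_le ((Q.measurable_S n).comp measurable_fst) measurable_snd).inter
        (measurableSet_lt measurable_snd ((Q.measurable_S m).comp measurable_fst))
    have hgs : Measurable (fun p : Ω × ℝ => g (Q.shift p.2 p.1)) :=
      hg.comp (Q.measurable_shift_comp measurable_snd measurable_fst)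
    exact (hgs.indicator hset)
  rw [Q.lintegral_departureMeasure (Measurable.lintegral_prod_right' (hmeasI (-1) 0))]
  have hmeas1 : ∀ n : ℤ, Measurable (fun p : Ω × ℝ => (Ioc (0 : ℝ) 1).indicator
      (1 : ℝ → ℝ≥0∞) (Q.S n p.1) *
        (Ico (Q.S (n - 1) p.1) (Q.S n p.1)).indicator (fun t => g (Q.shift t p.1)) p.2) := by
    intro n
    exact ((measurable_one.indicator measurableSet_Ioc).comp
      ((Q.measurable_S n).comp measurable_fst)).mul (hmeasI (n - 1) n)
  calc ∑' n : ℤ, ∫⁻ ω, (Ioc (0 : ℝ) 1).indicator 1 (Q.S n ω) *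
        ∫⁻ t, (Ico (Q.S (-1) (Q.shift (Q.S n ω) ω)) (Q.S 0 (Q.shift (Q.S n ω) ω))).indicator
          (fun t => g (Q.shift t (Q.shift (Q.S n ω) ω))) t ∂volume ∂P
      = ∑' n : ℤ, ∫⁻ ω, ∫⁻ t, (Ioc (0 : ℝ) 1).indicator 1 (Q.S n ω) *
          (Ico (Q.S (n - 1) ω) (Q.S n ω)).indicator (fun t => g (Q.shift t ω)) t ∂volume ∂P := by
        refine tsum_congr fun n => lintegral_congr fun ω => ?_
        have hI : Measurable (fun t => (Ico (Q.S (n - 1) ω) (Q.S n ω)).indicator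
            (fun t => g (Q.shift t ω)) t) :=
          (hmeasI (n - 1) n).comp measurable_prodMk_left
        rw [lintegral_const_mul _ hI]
        congr 1
        conv_rhs => rw [← lintegral_add_left_eq_self _ (Q.S n ω)]
        refine lintegral_congr fun t => ?_
        simp only [(Q.S_shift_S n ω).1, ← Q.shift_add]
        have e1 : -1 + n = n - 1 := by ring
        have e2 : t ∈ Ico (Q.S (-1 + n) ω - Q.S n ω) (Q.S (0 + n) ω - Q.S n ω) ↔
            Q.S n ω + t ∈ Ico (Q.S (n - 1) ω) (Q.S n ω) := by
          rw [e1, zero_add, mem_Ico, mem_Ico]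
          constructor <;> rintro ⟨a, b⟩ <;> constructor <;> linarith
        by_cases ht : Q.S n ω + t ∈ Ico (Q.S (n - 1) ω) (Q.S n ω)
        · rw [indicator_of_mem (e2.2 ht), indicator_of_mem ht]
        · rw [indicator_of_notMem (fun h => ht (e2.1 h)), indicator_of_notMem ht]
    _ = ∑' n : ℤ, ∫⁻ t, ∫⁻ ω, (Ioc (0 : ℝ) 1).indicator 1 (Q.S n ω) *
          (Ico (Q.S (n - 1) ω) (Q.S n ω)).indicator (fun t => g (Q.shift t ω)) t ∂P := by
        refine tsum_congr fun n => ?_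
        exact lintegral_lintegral_swap (hmeas1 n).aemeasurable
    _ = ∫⁻ t, ∫⁻ ω, ∑' n : ℤ, (Ioc (0 : ℝ) 1).indicator 1 (Q.S n ω) *
          (Ico (Q.S (n - 1) ω) (Q.S n ω)).indicator (fun t => g (Q.shift t ω)) t ∂P := by
        rw [← lintegral_tsum fun n => (hmeas1 n).lintegral_prod_left'.aemeasurable]
        refine lintegral_congr fun t => ?_
        exact (lintegral_tsum fun n =>
          ((hmeas1 n).comp (measurable_prodMk_right (y := t))).aemeasurable).symm
    _ = ∫⁻ t, ∫⁻ ω, (fun ω => (Ioc (0 : ℝ) 1).indicator 1 (Q.S 1 ω + t) * g ω)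
          (Q.shift t ω) ∂P := by
        refine lintegral_congr fun t => lintegral_congr fun ω => ?_
        -- the only departure that counts is the first one after time `t`
        obtain ⟨k, hk⟩ := Q.exists_S_shift t ω
        have h0 := Q.S_origin (Q.shift t ω)
        rw [hk, hk, zero_add] at h0
        have hmem : t ∈ Ico (Q.S (1 + k - 1) ω) (Q.S (1 + k) ω) := by
          rw [add_sub_cancel_left]
          exact ⟨by linarith [h0.1], by linarith [h0.2]⟩
        rw [tsum_eq_single (1 + k)]
        · simp only [hk, indicator_of_mem hmem, sub_add_cancel]
        · intro n hn
          rw [indicator_of_notMem (s := Ico _ _), mul_zero]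
          intro hn'
          apply hn
          have e1 : n - 1 < 1 + k :=
            (Q.strictMono_S ω).lt_iff_lt.1 (lt_of_le_of_lt hn'.1 hmem.2)
          have e2 : 1 + k - 1 < n :=
            (Q.strictMono_S ω).lt_iff_lt.1 (lt_of_le_of_lt hmem.1 hn'.2)
          omega
    _ = ∫⁻ t, ∫⁻ ω, (Ioc (0 : ℝ) 1).indicator 1 (Q.S 1 ω + t) * g ω ∂P := by
        refine lintegral_congr fun t => ?_
        have hm : Measurable (fun ω => (Ioc (0 : ℝ) 1).indicator 1 (Q.S 1 ω + t) * g ω) :=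
          ((measurable_one.indicator measurableSet_Ioc).comp
            ((Q.measurable_S 1).add_const t)).mul hg
        exact (MeasurePreserving.mk (Q.measurable_shift_comp measurable_const measurable_id)
          (Q.map_shift t)).lintegral_comp hm
    _ = ∫⁻ ω, ∫⁻ t, (Ioc (0 : ℝ) 1).indicator 1 (Q.S 1 ω + t) * g ω ∂volume ∂P := by
        rw [lintegral_lintegral_swap]
        exact (((measurable_one.indicator measurableSet_Ioc).comp
          (((Q.measurable_S 1).comp measurable_snd).add measurable_fst)).mul
            (hg.comp measurable_snd)).aemeasurable
    _ = ∫⁻ ω, g ω ∂P := by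
        refine lintegral_congr fun ω => ?_
        have hm : Measurable (fun t => (Ioc (0 : ℝ) 1).indicator (1 : ℝ → ℝ≥0∞) (Q.S 1 ω + t)) :=
          (measurable_one.indicator measurableSet_Ioc).comp (measurable_const_add _)
        rw [lintegral_mul_const _ hm,
          lintegral_add_left_eq_self (fun t => (Ioc (0 : ℝ) 1).indicator (1 : ℝ → ℝ≥0∞) t),
          lintegral_indicator_one measurableSet_Ioc]
        simp

end StationarySystem

/-! ### Regrouping independent variables -/

section Independence

variable {Ω : Type*} [MeasurableSpace Ω] {P : Measure Ω}

lemma iIndepFun_bool [IsProbabilityMeasure P] {X : Bool → Ω → ℝ} (hX : ∀ b, Measurable (X b))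
    (h : IndepFun (X false) (X true) P) : iIndepFun X P := by
  rw [iIndepFun_iff_map_fun_eq_pi_map fun b => (hX b).aemeasurable]
  have : ∀ b, IsProbabilityMeasure (P.map (X b)) := fun b =>
    Measure.isProbabilityMeasure_map (hX b).aemeasurable
  refine (Measure.pi_eq fun s hs => ?_).symm
  rw [Measure.map_apply (by fun_prop) (.univ_pi hs), Fintype.prod_bool,
    Measure.map_apply (hX _) (hs _), Measure.map_apply (hX _) (hs _), mul_comm,
    ← h.measure_inter_preimage_eq_mul _ _ (hs _) (hs _)]
  congr 1
  ext ω
  simp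

/-- If the pairs `(A n, B n)` are independent, with independent components, then so are the
staggered pairs `(B n, A (n + 1))`. -/
lemma iIndepFun_staggered [IsProbabilityMeasure P] {A B : ℤ → Ω → ℝ} (hA : ∀ n, Measurable (A n))
    (hB : ∀ n, Measurable (B n)) (h : iIndepFun (fun n ω => (A n ω, B n ω)) P)
    (hAB : ∀ n, IndepFun (A n) (B n) P) :
    iIndepFun (fun n ω => (B n ω, A (n + 1) ω)) P := by
  let W : ℤ → Bool → Ω → ℝ := fun n b => if b then B n else A n
  have hW : ∀ n b, Measurable (W n b) := by
    intro n b
    cases b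
    · exact hA n
    · exact hB n
  have h1 : iIndepFun (fun n ω => (W n · ω)) P := by
    have := h.comp (fun _ p (b : Bool) => if b then p.2 else p.1) (fun n => by
      refine measurable_pi_lambda _ fun b => ?_
      cases b
      · exact measurable_fst
      · exact measurable_snd)
    convert this using 3 with n ω
    funext b
    cases b <;> rfl
  have h2 : iIndepFun (fun (p : ℤ × Bool) ω => W p.1 p.2 ω) P :=
    iIndepFun_uncurry' hW h1 fun n => iIndepFun_bool (hW n) (hAB n)
  let g : (_ : ℤ) × Bool → ℤ × Bool := fun p => (if p.2 then p.1 else p.1 + 1, p.2)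
  have hg : g.Injective := by
    rintro ⟨n, b⟩ ⟨m, c⟩ hnm
    simp only [g, Prod.mk.injEq] at hnm
    obtain ⟨h3, rfl⟩ := hnm
    cases b <;> simp at h3 <;> simp [h3]
  have h3 : iIndepFun (fun (p : (_ : ℤ) × Bool) ω => W (g p).1 (g p).2 ω) P := h2.precomp hg
  let V : ℤ → Bool → Ω → ℝ := fun n b => W (g ⟨n, b⟩).1 (g ⟨n, b⟩).2
  have hV : ∀ n b, Measurable (V n b) := fun n b => hW _ _
  have : ∀ n b, IsProbabilityMeasure (P.map (V n b)) := fun n b =>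
    Measure.isProbabilityMeasure_map (hV n b).aemeasurable
  have h4 : P.map (fun ω n b => V n b ω) =
      Measure.infinitePi fun n => Measure.infinitePi fun b => P.map (V n b) := by
    rw [← Measure.infinitePi_map_piCurry (fun n b => P.map (V n b))]
    have h5 := (iIndepFun_iff_map_fun_eq_infinitePi_map (X := fun (p : (_ : ℤ) × Bool) ω =>
      V p.1 p.2 ω) (fun p => hV p.1 p.2)).1 h3
    rw [← h5, Measure.map_map (by fun_prop) (by fun_prop)]
    rfl
  have h6 : iIndepFun (fun n ω b => V n b ω) P := by
    rw [iIndepFun_iff_map_fun_eq_infinitePi_map (by fun_prop), h4]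
    congr 1
    funext n
    rw [show (fun ω b => V n b ω) = (fun v : ℤ → Bool → ℝ => v n) ∘ (fun ω n b => V n b ω) from rfl,
      ← Measure.map_map (by fun_prop) (by fun_prop), h4]
    exact (Measure.infinitePi_map_eval (fun n => Measure.infinitePi fun b => P.map (V n b)) n).symm
  exact h6.comp (fun _ v => (v true, v false)) fun n => by fun_prop

/-- Expectation of a product along an i.i.d. sequence whose first and last factors are special. -/
lemma lintegral_iid_prod {β : Type*} [MeasurableSpace β] {Y : ℕ → Ω → β} {ν : Measure β}
    (hY : ∀ n, Measurable (Y n)) (h : iIndepFun Y P) (hν : ∀ n, P.map (Y n) = ν)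
    {u f g : β → ℝ≥0∞} (hu : Measurable u) (hf : Measurable f) (hg : Measurable g) (l : ℕ) :
    ∫⁻ ω, u (Y 0 ω) * ((∏ j ∈ Finset.range l, f (Y (j + 1) ω)) * g (Y (l + 1) ω)) ∂P =
      (∫⁻ y, u y ∂ν) * ((∫⁻ y, f y ∂ν) ^ l * ∫⁻ y, g y ∂ν) := by
  let φ : ℕ → β → ℝ≥0∞ := fun n => if n = 0 then u else if n ≤ l then f else g
  have hφ : ∀ n, Measurable (φ n) := by
    intro n
    simp only [φ]
    split_ifs <;> assumption
  have hsplit : ∀ F : ℕ → ℝ≥0∞, ∏ n ∈ Finset.range (l + 2), F n =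
      F 0 * ((∏ j ∈ Finset.range l, F (j + 1)) * F (l + 1)) := by
    intro F
    rw [Finset.prod_range_succ', Finset.prod_range_succ, mul_comm]
  have hφ1 : ∀ j ∈ Finset.range l, φ (j + 1) = f := by
    intro j hj
    have : j + 1 ≤ l := Finset.mem_range.1 hj
    simp [φ, this]
  have h1 := lintegral_prod_eq_prod_lintegral_of_indepFun (Finset.range (l + 2))
    (fun n ω => φ n (Y n ω)) (h.comp φ hφ) fun n => (hφ n).comp (hY n)
  rw [hsplit] at h1
  simp only [hsplit] at h1
  have h2 : ∀ n, ∫⁻ ω, φ n (Y n ω) ∂P = ∫⁻ y, φ n y ∂ν := fun n => by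
    rw [← hν n, lintegral_map (hφ n) (hY n)]
  simp only [h2] at h1
  rw [Finset.prod_congr rfl fun j hj => by rw [hφ1 j hj], Finset.prod_const,
    Finset.card_range] at h1
  have e0 : φ 0 = u := by simp [φ]
  have el : φ (l + 1) = g := by simp [φ]
  rw [e0, el] at h1
  rw [← h1]
  refine lintegral_congr fun ω => ?_
  rw [Finset.prod_congr rfl fun j hj => by rw [← hφ1 j hj]]

end Independence

/-! ### The weight of a successful attempt -/

section Weights

/-- Contribution `1{y ≤ θ, y < x} e^{-s y}` of a message with service time `x` that is followed by
the next arrival after `y` units of time, when that arrival pushes it out. -/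
noncomputable def replacedWeight (θ : ℝ≥0∞) (s : ℝ) (p : ℝ × ℝ) : ℝ≥0∞ :=
  {p : ℝ × ℝ | ENNReal.ofReal p.2 ≤ θ ∧ p.2 < p.1}.indicator
    (fun p => ENNReal.ofReal (Real.exp (-(s * p.2)))) p

/-- Contribution `1{x < y} e^{-s x}` of a message with service time `x` that is followed by the next
arrival after `y` units of time, when it is served before that arrival. -/
noncomputable def servedWeight (s : ℝ) (p : ℝ × ℝ) : ℝ≥0∞ :=
  {p : ℝ × ℝ | p.1 < p.2}.indicator (fun p => ENNReal.ofReal (Real.exp (-(s * p.1)))) p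

@[fun_prop]
lemma measurable_replacedWeight (θ : ℝ≥0∞) (s : ℝ) : Measurable (replacedWeight θ s) := by
  have h : MeasurableSet {p : ℝ × ℝ | ENNReal.ofReal p.2 ≤ θ ∧ p.2 < p.1} :=
    (measurableSet_le measurable_snd.ennreal_ofReal measurable_const).inter
      (measurableSet_lt measurable_snd measurable_fst)
  exact Measurable.indicator (by fun_prop) h

@[fun_prop]
lemma measurable_servedWeight (s : ℝ) : Measurable (servedWeight s) :=
  Measurable.indicator (by fun_prop) (measurableSet_lt measurable_fst measurable_snd)

/-- The weight `e^{-s x - r y}` of the event that attempt `l` succeeds, where `x` is the time from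
the first arrival to the departure and `y` the service time of the departing message. -/
noncomputable def attemptWeight (θ : ℝ≥0∞) (s r : ℝ) (T σ : ℤ → ℝ) (l : ℕ) : ℝ≥0∞ :=
  (∏ j ∈ Finset.range l, replacedWeight θ s (σ (j + 1), T (j + 1 + 1) - T (j + 1))) *
    servedWeight (s + r) (σ (l + 1), T (l + 1 + 1) - T (l + 1))

open Classical in
lemma attemptWeight_eq (θ : ℝ≥0∞) (s r : ℝ) (T σ : ℤ → ℝ) (l : ℕ) :
    attemptWeight θ s r T σ l = if SucceedsAt θ T σ l then
      ENNReal.ofReal (Real.exp (-(s * (T (l + 1) + σ (l + 1) - T 1)) - r * σ (l + 1))) else 0 := by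
  by_cases h : SucceedsAt θ T σ l
  · rw [if_pos h, attemptWeight, servedWeight,
      indicator_of_mem (show (σ (l + 1), T (l + 1 + 1) - T (l + 1)) ∈ {p : ℝ × ℝ | p.1 < p.2}
        from h.2)]
    have h1 : ∀ k : ℕ, k ≤ l →
        ∏ j ∈ Finset.range k, replacedWeight θ s (σ (j + 1), T (j + 1 + 1) - T (j + 1)) =
          ENNReal.ofReal (Real.exp (-(s * (T (k + 1) - T 1)))) := by
      intro k hk
      induction k with
      | zero => simp
      | succ k ih =>
        rw [Finset.prod_range_succ, ih (by omega), replacedWeight,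
          indicator_of_mem (show (σ (k + 1), T (k + 1 + 1) - T (k + 1)) ∈
            {p : ℝ × ℝ | ENNReal.ofReal p.2 ≤ θ ∧ p.2 < p.1} from h.1 k (by omega)),
          ← ENNReal.ofReal_mul (Real.exp_nonneg _), ← Real.exp_add]
        congr 2
        push_cast
        ring
    rw [h1 l le_rfl, ← ENNReal.ofReal_mul (Real.exp_nonneg _), ← Real.exp_add]
    congr 2
    ring
  · rw [if_neg h, attemptWeight, mul_eq_zero]
    by_cases h2 : σ (l + 1) < T (l + 1 + 1) - T (l + 1)
    · left
      have h3 : ¬ ∀ j : ℕ, j < l → Replaced θ T σ (j + 1) := fun h3 => h ⟨h3, h2⟩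
      push Not at h3
      obtain ⟨j, hj, hj'⟩ := h3
      exact Finset.prod_eq_zero (Finset.mem_range.2 hj) (indicator_of_notMem
        (s := {p : ℝ × ℝ | ENNReal.ofReal p.2 ≤ θ ∧ p.2 < p.1}) hj' _)
    · right
      exact indicator_of_notMem (s := {p : ℝ × ℝ | p.1 < p.2}) h2 _

lemma tsum_attemptWeight_of_succeedsAt {θ : ℝ≥0∞} {T σ : ℤ → ℝ} {l : ℕ}
    (h : SucceedsAt θ T σ l) (s r : ℝ) : ∑' l, attemptWeight θ s r T σ l =
      ENNReal.ofReal (Real.exp (-(s * (T (l + 1) + σ (l + 1) - T 1)) - r * σ (l + 1))) := by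
  rw [tsum_eq_single l, attemptWeight_eq, if_pos h]
  intro l' hl'
  rw [attemptWeight_eq, if_neg fun h' => hl' (h'.eq h)]

lemma tsum_attemptWeight_of_not {θ : ℝ≥0∞} {T σ : ℤ → ℝ} (h : ∀ l, ¬ SucceedsAt θ T σ l)
    (s r : ℝ) : ∑' l, attemptWeight θ s r T σ l = 0 := by
  simp [attemptWeight_eq, h]

/-- The weights depend on the messages that arrive after time `0` only. -/
lemma measurable_attemptWeight {Ω : Type*} [MeasurableSpace Ω] {T σ : ℤ → Ω → ℝ}
    (hT : ∀ n, 1 ≤ n → Measurable (T n)) (hσ : ∀ n, 1 ≤ n → Measurable (σ n)) (θ : ℝ≥0∞)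
    (s r : ℝ) (l : ℕ) :
    Measurable (fun ω => attemptWeight θ s r (fun n => T n ω) (fun n => σ n ω) l) := by
  have h1 : ∀ j : ℕ, Measurable (fun ω => (σ (j + 1) ω, T (j + 1 + 1) ω - T (j + 1) ω)) := fun j =>
    (hσ _ (by omega)).prodMk ((hT _ (by omega)).sub (hT _ (by omega)))
  refine Measurable.mul (Finset.measurable_prod _ fun j _ => ?_) ?_
  · exact (measurable_replacedWeight θ s).comp (h1 j)
  · exact (measurable_servedWeight _).comp (h1 l)

lemma measurable_mul_tsum_attemptWeight {Ω : Type*} [MeasurableSpace Ω] {T σ : ℤ → Ω → ℝ}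
    (hT : ∀ n, 1 ≤ n → Measurable (T n)) (hσ : ∀ n, 1 ≤ n → Measurable (σ n)) (θ : ℝ≥0∞)
    (s r : ℝ) {u : ℝ → ℝ≥0∞} (hu : Measurable u) :
    Measurable (fun ω => u (T 1 ω) *
      ∑' l, attemptWeight θ s r (fun n => T n ω) (fun n => σ n ω) l) :=
  (hu.comp (hT 1 le_rfl)).mul (Measurable.tsum fun l => measurable_attemptWeight hT hσ θ s r l)

end Weights

namespace StationarySystem

variable {Ω : Type*} [MeasurableSpace Ω] {P : Measure Ω} {lam : ℝ} {G : Measure ℝ} {θ : ℝ≥0∞}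
  (Q : StationarySystem P lam G θ)

/-! ### Independence of the idle system and the later arrivals -/

lemma spacing_one (ω : Ω) : spacing (fun m => Q.T m ω) 1 = Q.T 1 ω := by
  simp [spacing, (Q.T_origin ω).1]

lemma spacing_of_two_le {n : ℤ} (hn : 2 ≤ n) (ω : Ω) :
    spacing (fun m => Q.T m ω) n = Q.T n ω - Q.T (n - 1) ω := by
  have h1 : Q.T 1 ω ≤ Q.T (n - 1) ω := (Q.strictMono_T ω).monotone (by omega)
  have h2 := (Q.T_origin ω).2
  rw [spacing, if_pos (by omega), max_eq_left (by linarith)]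

lemma measurable_spacing (n : ℤ) : Measurable (fun ω => spacing (fun m => Q.T m ω) n) := by
  unfold spacing
  have := Q.measurable_T
  split_ifs <;> fun_prop

variable [IsProbabilityMeasure G]

lemma map_spacing (hlam : 0 < lam) (n : ℤ) :
    P.map (fun ω => spacing (fun m => Q.T m ω) n) = expMeasure lam := by
  have := isProbabilityMeasure_expMeasure hlam
  have h := Q.law n
  have h2 : P.map (fun ω => spacing (fun m => Q.T m ω) n) =
      (P.map (fun ω => (spacing (fun m => Q.T m ω) n, Q.σ n ω))).map Prod.fst := by
    rw [Measure.map_map measurable_fst ((Q.measurable_spacing n).prodMk (Q.measurable_σ n))]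
    rfl
  rw [h2, h]
  exact Measure.map_fst_prod.trans (by simp)

lemma map_σ (hlam : 0 < lam) (n : ℤ) : P.map (Q.σ n) = G := by
  have := isProbabilityMeasure_expMeasure hlam
  have h := Q.law n
  have h2 : P.map (Q.σ n) =
      (P.map (fun ω => (spacing (fun m => Q.T m ω) n, Q.σ n ω))).map Prod.snd := by
    rw [Measure.map_map measurable_snd ((Q.measurable_spacing n).prodMk (Q.measurable_σ n))]
    rfl
  rw [h2, h]
  exact Measure.map_snd_prod.trans (by simp)

lemma ae_pos_σ (hlam : 0 < lam) (hG : ∀ᵐ x ∂G, 0 < x) : ∀ᵐ ω ∂P, ∀ n, 0 < Q.σ n ω := by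
  rw [ae_all_iff]
  intro n
  rw [← Q.map_σ hlam n] at hG
  exact ae_of_ae_map (Q.measurable_σ n).aemeasurable hG

variable [IsProbabilityMeasure P]

lemma iIndepFun_staggered_pairs (hlam : 0 < lam) :
    iIndepFun (fun n ω => (Q.σ n ω, spacing (fun m => Q.T m ω) (n + 1))) P ∧
      ∀ n, P.map (fun ω => (Q.σ n ω, spacing (fun m => Q.T m ω) (n + 1))) =
        G.prod (expMeasure lam) := by
  have hexp := isProbabilityMeasure_expMeasure hlam
  have hind : ∀ n, IndepFun (fun ω => spacing (fun m => Q.T m ω) n) (Q.σ n) P := by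
    intro n
    rw [indepFun_iff_map_prod_eq_prod_map_map (Q.measurable_spacing n).aemeasurable
      (Q.measurable_σ n).aemeasurable, Q.law, Q.map_spacing hlam, Q.map_σ hlam]
  refine ⟨iIndepFun_staggered (A := fun n ω => spacing (fun m => Q.T m ω) n) (B := Q.σ)
    Q.measurable_spacing Q.measurable_σ Q.iIndep hind, fun n => ?_⟩
  have h2 : IndepFun (Q.σ n) (fun ω => spacing (fun m => Q.T m ω) (n + 1)) P := by
    have h3 := Q.iIndep.indepFun (show n ≠ n + 1 by omega)
    exact h3.comp measurable_snd measurable_fst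
  rw [(indepFun_iff_map_prod_eq_prod_map_map (Q.measurable_σ n).aemeasurable
    (Q.measurable_spacing (n + 1)).aemeasurable).1 h2, Q.map_spacing hlam, Q.map_σ hlam]

/-- Expected weight of the successful attempts: a geometric series. -/
lemma lintegral_tsum_attemptWeight (hlam : 0 < lam) {u : ℝ → ℝ≥0∞} (hu : Measurable u) (s r : ℝ) :
    ∫⁻ ω, u (Q.T 1 ω) * ∑' l, attemptWeight θ s r (fun n => Q.T n ω) (fun n => Q.σ n ω) l ∂P =
      (∫⁻ t, u t ∂expMeasure lam) *
        ((1 - ∫⁻ p, replacedWeight θ s p ∂(G.prod (expMeasure lam)))⁻¹ *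
          ∫⁻ p, servedWeight (s + r) p ∂(G.prod (expMeasure lam))) := by
  have hexp := isProbabilityMeasure_expMeasure hlam
  obtain ⟨hind, hlaw⟩ := Q.iIndepFun_staggered_pairs hlam
  have hind' := hind.precomp (Nat.cast_injective (R := ℤ))
  have hu' : ∫⁻ p : ℝ × ℝ, u p.2 ∂(G.prod (expMeasure lam)) = ∫⁻ t, u t ∂expMeasure lam := by
    rw [lintegral_prod _ (by fun_prop)]
    simp
  rw [← ENNReal.tsum_geometric, ← hu', ← ENNReal.tsum_mul_right, ← ENNReal.tsum_mul_left]
  simp only [← ENNReal.tsum_mul_left]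
  have hm : ∀ l : ℕ, Measurable (fun ω => u (Q.T 1 ω) *
      attemptWeight θ s r (fun n => Q.T n ω) (fun n => Q.σ n ω) l) := fun l =>
    (hu.comp (Q.measurable_T 1)).mul (measurable_attemptWeight
      (fun n _ => Q.measurable_T n) (fun n _ => Q.measurable_σ n) θ s r l)
  rw [lintegral_tsum fun l => (hm l).aemeasurable]
  refine tsum_congr fun l => ?_
  rw [← lintegral_iid_prod (P := P)
    (Y := fun (n : ℕ) ω => (Q.σ n ω, spacing (fun m => Q.T m ω) (n + 1)))
    (fun n => (Q.measurable_σ n).prodMk (Q.measurable_spacing _)) hind' (fun n => hlaw n)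
    (u := fun p => u p.2) (by fun_prop) (measurable_replacedWeight θ s)
    (measurable_servedWeight (s + r)) l]
  refine lintegral_congr fun ω => ?_
  have e0 : spacing (fun m => Q.T m ω) (((0 : ℕ) : ℤ) + 1) = Q.T 1 ω := by
    simpa using Q.spacing_one ω
  have e1 : ∀ j : ℕ, spacing (fun m => Q.T m ω) (((j + 1 : ℕ) : ℤ) + 1) =
      Q.T (j + 1 + 1) ω - Q.T (j + 1) ω := by
    intro j
    rw [Q.spacing_of_two_le (by push_cast; omega)]
    push_cast
    simp
  simp only [e0, e1, attemptWeight]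
  push_cast
  rfl

omit [MeasurableSpace Ω] in
lemma measurable_indicator_one {m : MeasurableSpace Ω} {A : Set Ω} (hA : MeasurableSet[m] A) :
    Measurable[m] (A.indicator (1 : Ω → ℝ≥0∞)) := measurable_one.indicator hA

/-- By causality, an idle system at time `0` does not influence the later arrivals. -/
lemma lintegral_idle_mul (hlam : 0 < lam) {u : ℝ → ℝ≥0∞} (hu : Measurable u) (s r : ℝ) :
    ∫⁻ ω, {ω | (Q.X ω 0).cell₁ = none}.indicator 1 ω * (u (Q.T 1 ω) *
        ∑' l, attemptWeight θ s r (fun n => Q.T n ω) (fun n => Q.σ n ω) l) ∂P =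
      P {ω | (Q.X ω 0).cell₁ = none} * ((∫⁻ t, u t ∂expMeasure lam) *
        ((1 - ∫⁻ p, replacedWeight θ s p ∂(G.prod (expMeasure lam)))⁻¹ *
          ∫⁻ p, servedWeight (s + r) p ∂(G.prod (expMeasure lam)))) := by
  have hpast : Measurable[MeasurableSpace.comap (fun ω => (Q.X ω 0).cell₁) ⊤]
      ({ω | (Q.X ω 0).cell₁ = none}.indicator (1 : Ω → ℝ≥0∞)) :=
    measurable_indicator_one ⟨{none}, trivial, rfl⟩
  have hfut : Measurable[⨆ n : {n : ℤ // 1 ≤ n}, (MeasurableSpace.comap (Q.T n) inferInstance ⊔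
        MeasurableSpace.comap (Q.σ n) inferInstance)]
      (fun ω => u (Q.T 1 ω) *
        ∑' l, attemptWeight θ s r (fun n => Q.T n ω) (fun n => Q.σ n ω) l) := by
    have hT : ∀ n, 1 ≤ n → Measurable[⨆ n : {n : ℤ // 1 ≤ n},
        (MeasurableSpace.comap (Q.T n) inferInstance ⊔
          MeasurableSpace.comap (Q.σ n) inferInstance)] (Q.T n) := fun n hn =>
      Measurable.mono (comap_measurable (Q.T n)) (le_sup_left.trans
        (le_iSup (fun n : {n : ℤ // 1 ≤ n} => (MeasurableSpace.comap (Q.T n) inferInstance ⊔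
          MeasurableSpace.comap (Q.σ n) inferInstance)) ⟨n, hn⟩)) le_rfl
    have hσ : ∀ n, 1 ≤ n → Measurable[⨆ n : {n : ℤ // 1 ≤ n},
        (MeasurableSpace.comap (Q.T n) inferInstance ⊔
          MeasurableSpace.comap (Q.σ n) inferInstance)] (Q.σ n) := fun n hn =>
      Measurable.mono (comap_measurable (Q.σ n)) (le_sup_right.trans
        (le_iSup (fun n : {n : ℤ // 1 ≤ n} => (MeasurableSpace.comap (Q.T n) inferInstance ⊔
          MeasurableSpace.comap (Q.σ n) inferInstance)) ⟨n, hn⟩)) le_rfl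
    exact @measurable_mul_tsum_attemptWeight Ω (_) Q.T Q.σ hT hσ θ s r u hu
  have hle₁ : MeasurableSpace.comap (fun ω => (Q.X ω 0).cell₁) ⊤ ≤ ‹MeasurableSpace Ω› := by
    rintro _ ⟨A, -, rfl⟩
    have : (fun ω => (Q.X ω 0).cell₁) ⁻¹' A = ⋃ c ∈ A, {ω | (Q.X ω 0).cell₁ = c} := by
      ext ω; simp
    rw [this]
    exact MeasurableSet.biUnion (to_countable A) fun c _ => Q.measurable_cell₁ c
  have hle₂ : (⨆ n : {n : ℤ // 1 ≤ n}, (MeasurableSpace.comap (Q.T n) inferInstance ⊔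
      MeasurableSpace.comap (Q.σ n) inferInstance)) ≤ ‹MeasurableSpace Ω› :=
    iSup_le fun n => sup_le (Q.measurable_T n).comap_le (Q.measurable_σ n).comap_le
  rw [lintegral_mul_eq_lintegral_mul_lintegral_of_independent_measurableSpace hle₁ hle₂
    (indep_of_indep_of_le_left Q.causal (le_sup_right.trans le_sup_left)) hpast hfut,
    lintegral_indicator_one (Q.measurable_cell₁ _), Q.lintegral_tsum_attemptWeight hlam hu]

end StationarySystem

/-! ### The cycle between two departures that leave the system empty -/

lemma lintegral_exp_Ico {c a b : ℝ} (hc : 0 < c) (hab : a ≤ b) :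
    ∫⁻ t in Ico a b, ENNReal.ofReal (c * Real.exp (-(c * (b - t)))) =
      ENNReal.ofReal (1 - Real.exp (-(c * (b - a)))) := by
  have hcont : Continuous fun t => c * Real.exp (-(c * (b - t))) := by fun_prop
  rw [← ofReal_integral_eq_lintegral_ofReal]
  · congr 1
    rw [integral_Ico_eq_integral_Ioc, ← intervalIntegral.integral_of_le hab,
      intervalIntegral.integral_eq_sub_of_hasDerivAt
        (f := fun t => Real.exp (-(c * (b - t)))) (f' := fun t => c * Real.exp (-(c * (b - t))))]
    · simp
    · intro t _
      have h1 : HasDerivAt (fun t : ℝ => -(c * (b - t))) c t := by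
        refine ((((hasDerivAt_id t).const_sub b).const_mul c).fun_neg).congr_deriv ?_
        simp
      have := h1.exp
      rwa [mul_comm] at this
    · exact hcont.intervalIntegrable _ _
  · exact (hcont.integrableOn_Icc (a := a) (b := b)).mono_set Ico_subset_Icc_self
  · exact ae_of_all _ fun t => by positivity

namespace StationarySystem

variable {Ω : Type*} [MeasurableSpace Ω] {P : Measure Ω} {lam : ℝ} {G : Measure ℝ} {θ : ℝ≥0∞}
  (Q : StationarySystem P lam G θ)

/-- The event that both of the last two departures leave the system empty. -/
def emptyCycle : Set Ω := {ω | Q.K (-1) ω = 0 ∧ Q.K 0 ω = 0}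

/-- The time from the departure `S_{-1}` to the next arrival. -/
def idleTime (ω : Ω) : ℝ := Q.T 1 (Q.shift (Q.S (-1) ω) ω)

/-- The weight `e^{-s x - r y}`, where `x` is the time from the first arrival after `S_{-1}` to the
departure `S_0`, and `y` the time from the last arrival to `S_0`. -/
noncomputable def cycleWeight (s r : ℝ) (ω : Ω) : ℝ≥0∞ :=
  ENNReal.ofReal (Real.exp (-(s * (Q.S 0 ω - Q.S (-1) ω - Q.idleTime ω)) -
    r * (Q.S 0 ω - Q.T 0 ω)))

/-- The observable to which Palm inversion is applied: the system is idle at time `0`, the residual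
idle time is weighted by the density `c e^{-c t}`, the first departure after time `0` leaves the
system empty, and the current cycle is weighted by its `cycleWeight`. -/
noncomputable def idleObservable (c s r : ℝ) (ω : Ω) : ℝ≥0∞ :=
  {ω | (Q.X ω 0).cell₁ = none}.indicator 1 ω * ({ω | Q.K 1 ω = 0}.indicator 1 ω *
    (ENNReal.ofReal (c * Real.exp (-(c * Q.T 1 ω))) *
      ENNReal.ofReal (Real.exp (-(s * (Q.S 1 ω - Q.T 1 ω)) -
        r * (-Q.T 0 (Q.shift (Q.S 1 ω) ω))))))

lemma measurableSet_emptyCycle : MeasurableSet Q.emptyCycle :=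
  (Q.measurable_K (-1) (measurableSet_singleton 0)).inter
    (Q.measurable_K 0 (measurableSet_singleton 0))

@[fun_prop]
lemma measurable_idleTime : Measurable Q.idleTime :=
  (Q.measurable_T 1).comp (Q.measurable_shift_S (-1))

lemma measurable_cycleWeight (s r : ℝ) : Measurable (Q.cycleWeight s r) := by
  have h1 := Q.measurable_S 0
  have h2 := Q.measurable_S (-1)
  have h3 := Q.measurable_T 0
  unfold cycleWeight
  fun_prop

lemma measurable_idleObservable (c s r : ℝ) : Measurable (Q.idleObservable c s r) := by
  have h1 := Q.measurable_S 1
  have h2 := Q.measurable_T 1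
  have h3 := (Q.measurable_T 0).comp (Q.measurable_shift_S 1)
  have h4 := measurable_one.indicator (β := ℝ≥0∞) Q.measurableSet_cell₁_none
  have h5 := measurable_one.indicator (β := ℝ≥0∞) (Q.measurable_K 1 (measurableSet_singleton 0))
  refine h4.mul (h5.mul (Measurable.mul
    (((h2.const_mul c).neg.exp.const_mul c).ennreal_ofReal) ?_))
  refine (Real.measurable_exp.comp
    (Measurable.sub (((h1.sub h2).const_mul s).neg) (h3.neg.const_mul r))).ennreal_ofReal

/-- Seen from a time in `[T_n, T_{n+1})`, the last arrival is that of message `n`. -/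
lemma T_shift_of_mem {t : ℝ} {ω : Ω} {n : ℤ} (h₁ : Q.T n ω ≤ t) (h₂ : t < Q.T (n + 1) ω) (m : ℤ) :
    Q.T m (Q.shift t ω) = Q.T (m + n) ω - t := by
  obtain ⟨k, hk, -, -⟩ := Q.covariant t ω
  have h0 := Q.T_origin (Q.shift t ω)
  rw [hk, hk, zero_add] at h0
  have e1 : k < n + 1 := (Q.strictMono_T ω).lt_iff_lt.1 (by linarith [h0.1])
  have e2 : n < 1 + k := (Q.strictMono_T ω).lt_iff_lt.1 (by linarith [h0.2])
  obtain rfl : k = n := by omega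
  exact hk m

lemma K_eq_zero_iff {ω : Ω} (hω : ∀ n, 0 < Q.σ n ω) (n : ℤ) :
    Q.K n ω = 0 ↔ (Q.X ω (Q.S n ω)).cell₁ = none :=
  (Q.isRegularTrajectory hω).count_eq_zero_iff

/-- An idle system whose next departure leaves it empty goes through a successful attempt. -/
lemma idleObservable_eq {ω : Ω} (hω : ∀ n, 0 < Q.σ n ω) (c s r : ℝ) :
    Q.idleObservable c s r ω = {ω | (Q.X ω 0).cell₁ = none}.indicator 1 ω *
      (ENNReal.ofReal (c * Real.exp (-(c * Q.T 1 ω))) *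
        ∑' l, attemptWeight θ s r (fun n => Q.T n ω) (fun n => Q.σ n ω) l) := by
  by_cases he : (Q.X ω 0).cell₁ = none
  swap
  · have he' : ω ∉ {ω | (Q.X ω 0).cell₁ = none} := he
    rw [idleObservable, indicator_of_notMem he', zero_mul, zero_mul]
  rw [idleObservable]
  congr 1
  have h := Q.isRegularTrajectory hω
  obtain ⟨h₀, h₁⟩ := Q.T_origin ω
  obtain ⟨hS₀, hS₁⟩ := Q.S_origin ω
  obtain ⟨i, hi⟩ := Q.departsAt_S 1 ω
  have hfirst : ∀ i' d, DepartsAt (fun n => Q.σ n ω) (Q.X ω) i' d → 0 < d → Q.S 1 ω ≤ d := by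
    intro i' d hd hd0
    obtain ⟨n, rfl⟩ := Q.exists_S_eq hd
    have : 0 < n := (Q.strictMono_S ω).lt_iff_lt.1 (by linarith)
    exact (Q.strictMono_S ω).monotone (by omega : 1 ≤ n)
  by_cases hK : Q.K 1 ω = 0
  · have hK' : ω ∈ {ω | Q.K 1 ω = 0} := hK
    rw [indicator_of_mem hK', Pi.one_apply, one_mul]
    congr 1
    obtain ⟨l, hl⟩ := h.exists_succeedsAt_of_empty h₀ h₁ he hi hS₁ hfirst
      ((Q.K_eq_zero_iff hω 1).1 hK)
    have hS := (h.first_departure_of_succeedsAt h₀ h₁ he hl hi hS₁ hfirst).1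
    rw [tsum_attemptWeight_of_succeedsAt hl,
      Q.T_shift_of_mem (n := l + 1) (by rw [hS]; linarith [hω (l + 1)])
        (by rw [hS]; linarith [hl.2])]
    congr 2
    rw [hS]
    simp only [zero_add]
    ring
  · have hK' : ω ∉ {ω | Q.K 1 ω = 0} := hK
    rw [indicator_of_notMem hK', zero_mul, tsum_attemptWeight_of_not, mul_zero]
    intro l hl
    exact hK ((Q.K_eq_zero_iff hω 1).2
      (h.first_departure_of_succeedsAt h₀ h₁ he hl hi hS₁ hfirst).2)

/-- No departure falls between `S_{-1}` and `S_0`. -/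
lemma S_zero_le_of_departsAt {ω : Ω} {i : ℤ} {d : ℝ}
    (h : DepartsAt (fun n => Q.σ n ω) (Q.X ω) i d) (h₁ : Q.S (-1) ω < d) : Q.S 0 ω ≤ d := by
  obtain ⟨n, rfl⟩ := Q.exists_S_eq h
  have : -1 < n := (Q.strictMono_S ω).lt_iff_lt.1 h₁
  exact (Q.strictMono_S ω).monotone (by omega : 0 ≤ n)

lemma idleTime_pos (ω : Ω) : 0 < Q.idleTime ω := (Q.T_origin _).2

/-- The integral of the observable over the cycle that ends with the departure at time `0`: the
system is idle from `S_{-1}` until the next arrival, and the weight `c e^{-c t}` of the residual idle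
time integrates to `1 - e^{-c I}` over an idle time of length `I`. -/
lemma lintegral_idleObservable_shift {ω : Ω} (hω : ∀ n, 0 < Q.σ n ω) (h0 : Q.S 0 ω = 0)
    {c : ℝ} (hc : 0 < c) (s r : ℝ) :
    ∫⁻ t, (Ico (Q.S (-1) ω) (Q.S 0 ω)).indicator (fun t => Q.idleObservable c s r (Q.shift t ω)) t =
      Q.emptyCycle.indicator (fun ω => ENNReal.ofReal (1 - Real.exp (-(c * Q.idleTime ω))) *
        Q.cycleWeight s r ω) ω := by
  have h := Q.isRegularTrajectory hω
  -- the observable, seen from a time of the cycle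
  have hobs : ∀ t ∈ Ico (Q.S (-1) ω) (Q.S 0 ω), Q.idleObservable c s r (Q.shift t ω) =
      {ω | (Q.X ω 0).cell₁ = none}.indicator 1 (Q.shift t ω) * ({ω | Q.K 0 ω = 0}.indicator 1 ω *
        (ENNReal.ofReal (c * Real.exp (-(c * Q.T 1 (Q.shift t ω)))) *
          ENNReal.ofReal (Real.exp (-(s * (-t - Q.T 1 (Q.shift t ω))) - r * (-Q.T 0 ω))))) := by
    intro t ht
    obtain ⟨hS, hK⟩ := Q.S_shift_of_mem (n := 0) (by simpa using ht.1) ht.2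
    have e1 : Q.S 1 (Q.shift t ω) = -t := by rw [hS]; simp [h0]
    have e2 : Q.K 1 (Q.shift t ω) = Q.K 0 ω := by rw [hK]; simp
    have e3 : Q.shift (-t) (Q.shift t ω) = ω := by
      rw [← Q.shift_add, add_neg_cancel, Q.shift_zero]
    rw [idleObservable, e1, e3]
    simp only [indicator, mem_ofPred_eq, e2, Pi.one_apply]
  obtain ⟨k, hk, hk'⟩ := h.exists_mem_Ico (Q.S (-1) ω)
  have hJ : Q.idleTime ω = Q.T (k + 1) ω - Q.S (-1) ω := by
    rw [idleTime, Q.T_shift_of_mem hk hk', add_comm]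
  by_cases hA : ω ∈ Q.emptyCycle
  swap
  · rw [indicator_of_notMem hA]
    refine (lintegral_congr fun t => ?_).trans lintegral_zero
    by_cases ht : t ∈ Ico (Q.S (-1) ω) (Q.S 0 ω)
    swap
    · exact indicator_of_notMem ht _
    rw [indicator_of_mem ht, hobs t ht]
    by_cases hK0 : Q.K 0 ω = 0
    swap
    · rw [indicator_of_notMem (s := {ω | Q.K 0 ω = 0}) hK0]; simp
    have hX : Q.shift t ω ∉ {ω | (Q.X ω 0).cell₁ = none} := by
      intro hX
      have hX' := (Q.cell₁_shift_eq_none t 0 ω).1 hX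
      rw [zero_add] at hX'
      have hK1 : Q.K (-1) ω ≠ 0 := fun hK1 => hA ⟨hK1, hK0⟩
      obtain ⟨i, d, hd, hd1, hd2⟩ := h.exists_departure_of_empty ht.1
        (fun hc => hK1 ((Q.K_eq_zero_iff hω _).2 hc)) hX'
      linarith [Q.S_zero_le_of_departsAt hd hd1, ht.2]
    rw [indicator_of_notMem hX, zero_mul]
  · rw [indicator_of_mem hA]
    have hempty := (Q.K_eq_zero_iff hω _).1 hA.1
    have hnone : ∀ t, Q.S (-1) ω ≤ t → t < Q.T (k + 1) ω → (Q.X ω t).cell₁ = none := by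
      intro t ht1 ht2
      refine h.empty_of_empty ht1 hempty fun n hn => ?_
      have e1 : k < n := (Q.strictMono_T ω).lt_iff_lt.1 (by linarith [hn.1])
      have e2 : n < k + 1 := (Q.strictMono_T ω).lt_iff_lt.1 (by linarith [hn.2])
      omega
    have hJ0 : Q.T (k + 1) ω ≤ Q.S 0 ω := by
      by_contra hc
      obtain ⟨i, hi⟩ := Q.departsAt_S 0 ω
      obtain ⟨r, hr1, hr2, hr3, -⟩ := h.exists_before_departure hi
        (Q.strictMono_S ω (by omega : (-1 : ℤ) < 0))
      rw [hnone r hr1 (by linarith)] at hr3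
      simp at hr3
    have hiff : ∀ t, (Ico (Q.S (-1) ω) (Q.S 0 ω)).indicator
        (fun t => Q.idleObservable c s r (Q.shift t ω)) t =
        (Ico (Q.S (-1) ω) (Q.T (k + 1) ω)).indicator
          (fun t => ENNReal.ofReal (c * Real.exp (-(c * (Q.T (k + 1) ω - t))))) t *
            Q.cycleWeight s r ω := by
      intro t
      by_cases ht : t ∈ Ico (Q.S (-1) ω) (Q.T (k + 1) ω)
      · have ht' : t ∈ Ico (Q.S (-1) ω) (Q.S 0 ω) := ⟨ht.1, lt_of_lt_of_le ht.2 hJ0⟩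
        have hX : Q.shift t ω ∈ {ω | (Q.X ω 0).cell₁ = none} := by
          refine (Q.cell₁_shift_eq_none t 0 ω).2 ?_
          rw [zero_add]
          exact hnone t ht.1 ht.2
        have hK0 : ω ∈ {ω | Q.K 0 ω = 0} := hA.2
        have hT1 : Q.T 1 (Q.shift t ω) = Q.T (k + 1) ω - t := by
          rw [Q.T_shift_of_mem (hk.trans ht.1) ht.2, add_comm]
        rw [indicator_of_mem ht, indicator_of_mem ht', hobs t ht', indicator_of_mem hX,
          indicator_of_mem hK0, Pi.one_apply, Pi.one_apply, one_mul, one_mul, hT1, cycleWeight,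
          h0, hJ]
        congr 3
        ring
      · rw [indicator_of_notMem ht, zero_mul]
        by_cases ht' : t ∈ Ico (Q.S (-1) ω) (Q.S 0 ω)
        swap
        · exact indicator_of_notMem ht' _
        have hX : Q.shift t ω ∉ {ω | (Q.X ω 0).cell₁ = none} := by
          intro hX
          have hX' := (Q.cell₁_shift_eq_none t 0 ω).1 hX
          rw [zero_add] at hX'
          have hTt : Q.T (k + 1) ω ≤ t := not_lt.1 fun hlt => ht ⟨ht'.1, hlt⟩
          obtain ⟨i, d, hd, hd1, hd2⟩ := h.exists_departure_of_empty hTt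
            (h.arrival_cell₁ (k + 1)) hX'
          linarith [Q.S_zero_le_of_departsAt hd (by linarith), ht'.2]
        rw [indicator_of_mem ht', hobs t ht', indicator_of_notMem hX, zero_mul]
    rw [lintegral_congr hiff, lintegral_mul_const _
      (Measurable.indicator (by fun_prop) measurableSet_Ico), lintegral_indicator measurableSet_Ico,
      lintegral_exp_Ico hc hk'.le, hJ]

end StationarySystem

/-! ### Exponential and Laplace transforms -/

lemma lintegral_expMeasure (lam : ℝ) {f : ℝ → ℝ≥0∞} (hf : Measurable f) :
    ∫⁻ t, f t ∂expMeasure lam =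
      ∫⁻ t in Ici 0, ENNReal.ofReal (lam * Real.exp (-(lam * t))) * f t := by
  have h1 : expMeasure lam = volume.withDensity (exponentialPDF lam) := rfl
  have hm : Measurable (exponentialPDF lam) :=
    (measurable_exponentialPDFReal lam).ennreal_ofReal
  rw [h1, lintegral_withDensity_eq_lintegral_mul _ hm hf, ← lintegral_indicator measurableSet_Ici]
  refine lintegral_congr fun t => ?_
  rw [Pi.mul_apply, exponentialPDF_eq]
  by_cases ht : 0 ≤ t
  · rw [if_pos ht, indicator_of_mem (show t ∈ Ici (0 : ℝ) from ht)]
  · rw [if_neg ht, indicator_of_notMem (show t ∉ Ici (0 : ℝ) from ht)]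
    simp

lemma expMeasure_singleton (lam x : ℝ) : expMeasure lam {x} = 0 := by
  have h1 : expMeasure lam = volume.withDensity (exponentialPDF lam) := rfl
  rw [h1]
  exact withDensity_absolutelyContinuous _ _ (by simp)

lemma expMeasure_Ioi {lam x : ℝ} (hlam : 0 < lam) (hx : 0 ≤ x) :
    expMeasure lam (Ioi x) = ENNReal.ofReal (Real.exp (-(lam * x))) := by
  have := isProbabilityMeasure_expMeasure hlam
  have h1 := cdf_expMeasure_eq hlam x
  rw [if_pos hx, cdf_eq_real] at h1
  rw [← compl_Iic, ← ofReal_measureReal, probReal_compl_eq_one_sub measurableSet_Iic, h1]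
  congr 1
  ring

lemma lintegral_exp_expMeasure {lam c : ℝ} (hlam : 0 < lam) (hc : 0 ≤ c) :
    ∫⁻ t, ENNReal.ofReal (Real.exp (-(c * t))) ∂expMeasure lam =
      ENNReal.ofReal (lam / (lam + c)) := by
  have hpos : 0 < lam + c := by linarith
  have := isProbabilityMeasure_expMeasure hpos
  have h1 : ∫⁻ _, 1 ∂expMeasure (lam + c) = 1 := by simp
  rw [lintegral_expMeasure _ measurable_const] at h1
  rw [lintegral_expMeasure _ (by fun_prop)]
  calc _ = ∫⁻ t in Ici 0, ENNReal.ofReal (lam / (lam + c)) *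
        (ENNReal.ofReal ((lam + c) * Real.exp (-((lam + c) * t))) * 1) := by
        refine lintegral_congr fun t => ?_
        rw [mul_one, ← ENNReal.ofReal_mul (by positivity), ← ENNReal.ofReal_mul (by positivity)]
        congr 1
        rw [mul_assoc, ← Real.exp_add, ← mul_assoc, div_mul_cancel₀ _ hpos.ne']
        congr 2
        ring
    _ = _ := by rw [lintegral_const_mul _ (by fun_prop), h1, mul_one]

section Transforms

variable {lam : ℝ} {G : Measure ℝ} [IsProbabilityMeasure G]

lemma integrable_exp_neg (hG : ∀ᵐ x ∂G, 0 < x) {s : ℝ} (hs : 0 ≤ s) :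
    Integrable (fun x => Real.exp (-(s * x))) G := by
  refine Integrable.of_bound (C := 1) (by fun_prop) (hG.mono fun x hx => ?_)
  rw [Real.norm_eq_abs, abs_of_pos (Real.exp_pos _), Real.exp_le_one_iff]
  have := mul_nonneg hs hx.le
  linarith

lemma laplace_pos (hG : ∀ᵐ x ∂G, 0 < x) {s : ℝ} (hs : 0 ≤ s) : 0 < laplace G s :=
  integral_exp_pos (integrable_exp_neg hG hs)

lemma lintegral_servedWeight (hlam : 0 < lam) (hG : ∀ᵐ x ∂G, 0 < x) {s : ℝ} (hs : 0 ≤ s) :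
    ∫⁻ p, servedWeight s p ∂(G.prod (expMeasure lam)) = ENNReal.ofReal (laplace G (s + lam)) := by
  have := isProbabilityMeasure_expMeasure hlam
  rw [lintegral_prod _ (by fun_prop), laplace, ofReal_integral_eq_lintegral_ofReal
    (integrable_exp_neg hG (by linarith)) (ae_of_all _ fun x => Real.exp_nonneg _)]
  refine lintegral_congr_ae (hG.mono fun x hx => ?_)
  have h1 : ∀ y, servedWeight s (x, y) =
      (Ioi x).indicator (fun _ => ENNReal.ofReal (Real.exp (-(s * x)))) y := fun y => rfl
  simp only [h1]
  rw [lintegral_indicator measurableSet_Ioi, setLIntegral_const, expMeasure_Ioi hlam hx.le,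
    ← ENNReal.ofReal_mul (Real.exp_nonneg _), ← Real.exp_add]
  congr 2
  ring

/-- The expected weight of a replacement, `q Ĵ(s)`, as an integral over the time `y` of the next
arrival: the message is still in service with probability `1 - G(y)`. -/
lemma lintegral_replacedWeight (hlam : 0 < lam) (θ : ℝ≥0∞) (s : ℝ) :
    ∫⁻ p, replacedWeight θ s p ∂(G.prod (expMeasure lam)) =
      ∫⁻ y in {y : ℝ | 0 ≤ y ∧ ENNReal.ofReal y < θ},
        ENNReal.ofReal (lam * Real.exp (-(lam * y)) * (1 - cdf G y)) *
          ENNReal.ofReal (Real.exp (-(s * y))) := by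
  have := isProbabilityMeasure_expMeasure hlam
  rw [lintegral_prod_symm _ (by fun_prop)]
  have h1 : ∀ y, ∫⁻ x, replacedWeight θ s (x, y) ∂G =
      {y : ℝ | ENNReal.ofReal y ≤ θ}.indicator
        (fun y => ENNReal.ofReal (Real.exp (-(s * y))) * ENNReal.ofReal (1 - cdf G y)) y := by
    intro y
    have hcdf : ENNReal.ofReal (1 - cdf G y) = G (Ioi y) := by
      rw [cdf_eq_real, ← probReal_compl_eq_one_sub measurableSet_Iic, compl_Iic,
        ofReal_measureReal]
    by_cases hy : ENNReal.ofReal y ≤ θ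
    · rw [indicator_of_mem (s := {y : ℝ | ENNReal.ofReal y ≤ θ}) hy, hcdf]
      have h2 : ∀ x, replacedWeight θ s (x, y) =
          (Ioi y).indicator (fun _ => ENNReal.ofReal (Real.exp (-(s * y)))) x := by
        intro x
        simp [replacedWeight, indicator, hy]
      simp only [h2]
      rw [lintegral_indicator measurableSet_Ioi, setLIntegral_const]
    · rw [indicator_of_notMem (s := {y : ℝ | ENNReal.ofReal y ≤ θ}) hy]
      simp [replacedWeight, indicator, hy]
  have hmeas : Measurable (fun y => ∫⁻ x, replacedWeight θ s (x, y) ∂G) :=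
    (measurable_replacedWeight θ s).lintegral_prod_left'
  have hset1 : MeasurableSet {y : ℝ | 0 ≤ y ∧ ENNReal.ofReal y < θ} :=
    measurableSet_Ici.inter (measurableSet_lt ENNReal.measurable_ofReal measurable_const)
  rw [lintegral_expMeasure _ hmeas, ← lintegral_indicator measurableSet_Ici,
    ← lintegral_indicator hset1]
  -- the integrands differ at `y = θ` only
  have hne : ∀ᵐ y : ℝ, y ≠ θ.toReal := by simp [ae_iff]
  refine lintegral_congr_ae (hne.mono fun y hy => ?_)
  simp only [h1]
  by_cases hy0 : 0 ≤ y
  swap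
  · rw [indicator_of_notMem (show y ∉ Ici (0 : ℝ) from hy0),
      indicator_of_notMem (s := {y : ℝ | 0 ≤ y ∧ ENNReal.ofReal y < θ}) fun h => hy0 h.1]
  rw [indicator_of_mem (show y ∈ Ici (0 : ℝ) from hy0)]
  have hne' : ENNReal.ofReal y ≠ θ := fun h => hy (by rw [← h, ENNReal.toReal_ofReal hy0])
  by_cases hyθ : ENNReal.ofReal y < θ
  · rw [indicator_of_mem (s := {y : ℝ | ENNReal.ofReal y ≤ θ}) hyθ.le,
      indicator_of_mem (s := {y : ℝ | 0 ≤ y ∧ ENNReal.ofReal y < θ}) ⟨hy0, hyθ⟩,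
      ENNReal.ofReal_mul (q := 1 - cdf G y) (by positivity)]
    ring
  · rw [indicator_of_notMem (s := {y : ℝ | ENNReal.ofReal y ≤ θ})
        fun h => hyθ (lt_of_le_of_ne h hne'),
      indicator_of_notMem (s := {y : ℝ | 0 ≤ y ∧ ENNReal.ofReal y < θ}) fun h => hyθ h.2, mul_zero]

/-- The probability `q` is the expected weight of a replacement, without discount. -/
lemma qProb_eq (hlam : 0 < lam) (hG : ∀ᵐ x ∂G, 0 < x) (θ : ℝ≥0∞) :
    qProb lam G θ = (∫⁻ p, replacedWeight θ 0 p ∂(G.prod (expMeasure lam))).toReal := by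
  have := isProbabilityMeasure_expMeasure hlam
  have hA : MeasurableSet {p : ℝ × ℝ | min θ (ENNReal.ofReal p.2) < ENNReal.ofReal p.1} :=
    measurableSet_lt (by fun_prop) (by fun_prop)
  have hB : MeasurableSet {p : ℝ × ℝ | ENNReal.ofReal p.2 ≤ θ ∧ p.2 < p.1} :=
    (measurableSet_le measurable_snd.ennreal_ofReal measurable_const).inter
      (measurableSet_lt measurable_snd measurable_fst)
  rw [qProb, ← probReal_compl_eq_one_sub hA, Measure.real]
  have h1 : ∫⁻ p, replacedWeight θ 0 p ∂(G.prod (expMeasure lam)) =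
      (G.prod (expMeasure lam)) {p : ℝ × ℝ | ENNReal.ofReal p.2 ≤ θ ∧ p.2 < p.1} := by
    rw [← lintegral_indicator_one hB]
    refine lintegral_congr fun p => ?_
    simp [replacedWeight, indicator]
  rw [h1, ← Measure.prod_swap, Measure.map_apply measurable_swap hA.compl]
  congr 1
  refine measure_congr ?_
  have hdiag : ∀ᵐ p ∂(G.prod (expMeasure lam)), p.1 ≠ p.2 := by
    have hm : MeasurableSet {p : ℝ × ℝ | p.1 = p.2} :=
      measurableSet_eq_fun measurable_fst measurable_snd
    have h0 : (G.prod (expMeasure lam)) {p : ℝ × ℝ | p.1 = p.2} = 0 := by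
      rw [Measure.measure_prod_null hm]
      refine ae_of_all _ fun x => ?_
      have : Prod.mk x ⁻¹' {p : ℝ × ℝ | p.1 = p.2} = {x} := by
        ext y; simp [eq_comm]
      simp only [this, expMeasure_singleton, Pi.zero_apply]
    exact measure_eq_zero_iff_ae_notMem.1 h0
  have hpos : ∀ᵐ p ∂(G.prod (expMeasure lam)), 0 < p.1 :=
    Measure.quasiMeasurePreserving_fst.ae hG
  filter_upwards [hdiag, hpos] with p h1 h2
  refine propext ?_
  change ¬ (min θ (ENNReal.ofReal p.1) < ENNReal.ofReal p.2) ↔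
    (ENNReal.ofReal p.2 ≤ θ ∧ p.2 < p.1)
  rw [not_lt, le_min_iff, ENNReal.ofReal_le_ofReal_iff h2.le]
  exact and_congr_right fun _ => ⟨fun h => lt_of_le_of_ne h (Ne.symm h1), le_of_lt⟩

lemma lintegral_replacedWeight_le (hlam : 0 < lam) (θ : ℝ≥0∞) {s : ℝ} (hs : 0 ≤ s) :
    ∫⁻ p, replacedWeight θ s p ∂(G.prod (expMeasure lam)) ≤
      ∫⁻ p, replacedWeight θ 0 p ∂(G.prod (expMeasure lam)) := by
  rw [lintegral_replacedWeight hlam, lintegral_replacedWeight hlam]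
  have hset : MeasurableSet {y : ℝ | 0 ≤ y ∧ ENNReal.ofReal y < θ} :=
    measurableSet_Ici.inter (measurableSet_lt ENNReal.measurable_ofReal measurable_const)
  refine setLIntegral_mono' hset fun y hy => ?_
  have := mul_nonneg hs hy.1
  exact mul_le_mul' le_rfl (ENNReal.ofReal_le_ofReal (Real.exp_le_exp.2 (by linarith)))

/-- A message is pushed out with probability less than one, since it may be served before the next
arrival. -/
lemma lintegral_replacedWeight_lt_one (hlam : 0 < lam) (hG : ∀ᵐ x ∂G, 0 < x) (θ : ℝ≥0∞) {s : ℝ}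
    (hs : 0 ≤ s) : ∫⁻ p, replacedWeight θ s p ∂(G.prod (expMeasure lam)) < 1 := by
  have := isProbabilityMeasure_expMeasure hlam
  refine (lintegral_replacedWeight_le hlam θ hs).trans_lt ?_
  have h1 : ∫⁻ p, replacedWeight θ 0 p ∂(G.prod (expMeasure lam)) +
      ∫⁻ p, servedWeight 0 p ∂(G.prod (expMeasure lam)) ≤ 1 := by
    rw [← lintegral_add_left (by fun_prop)]
    calc _ ≤ ∫⁻ _, 1 ∂(G.prod (expMeasure lam)) := by
          refine lintegral_mono fun p => ?_
          rcases lt_or_ge p.2 p.1 with h | h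
          · rw [servedWeight, indicator_of_notMem (show p ∉ {p : ℝ × ℝ | p.1 < p.2} from h.not_gt)]
            simp only [replacedWeight, indicator]
            split_ifs <;> simp
          · rw [replacedWeight, indicator_of_notMem
              (show p ∉ {p : ℝ × ℝ | ENNReal.ofReal p.2 ≤ θ ∧ p.2 < p.1} from
                fun hc => h.not_gt hc.2)]
            simp only [servedWeight, indicator]
            split_ifs <;> simp
      _ = 1 := by simp
  rw [lintegral_servedWeight hlam hG le_rfl] at h1
  have h2 : 0 < ENNReal.ofReal (laplace G (0 + lam)) :=
    ENNReal.ofReal_pos.2 (laplace_pos hG (by linarith))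
  have hfin : ∫⁻ p, replacedWeight θ 0 p ∂(G.prod (expMeasure lam)) ≠ ∞ :=
    ne_top_of_le_ne_top ENNReal.one_ne_top (le_self_add.trans h1)
  exact lt_of_lt_of_le (ENNReal.lt_add_right hfin h2.ne') h1

/-- In the product `q Ĵ(s)` the normalisation of the law `J` cancels. -/
lemma qProb_mul_laplace_lawJ (hlam : 0 < lam) (hG : ∀ᵐ x ∂G, 0 < x) (θ : ℝ≥0∞) {s : ℝ}
    (hs : 0 ≤ s) : qProb lam G θ * laplace (lawJ lam G θ) s =
      (∫⁻ p, replacedWeight θ s p ∂(G.prod (expMeasure lam))).toReal := by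
  have hq := qProb_eq hlam hG θ
  have hq0 : 0 ≤ qProb lam G θ := hq ▸ ENNReal.toReal_nonneg
  rcases hq0.eq_or_lt with h0 | hpos
  · -- if `q = 0`, no message is ever pushed out
    have hle := lintegral_replacedWeight_le (G := G) hlam θ hs
    have hlt := lintegral_replacedWeight_lt_one hlam hG θ le_rfl
    rw [← h0] at hq
    have hz : ∫⁻ p, replacedWeight θ 0 p ∂(G.prod (expMeasure lam)) = 0 := by
      rcases (ENNReal.toReal_eq_zero_iff _).1 hq.symm with h | h
      · exact h
      · exact absurd h hlt.ne_top
    rw [hz, nonpos_iff_eq_zero] at hle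
    rw [← h0, hle]
    simp
  · have hset : MeasurableSet {y : ℝ | 0 ≤ y ∧ ENNReal.ofReal y < θ} :=
      measurableSet_Ici.inter (measurableSet_lt ENNReal.measurable_ofReal measurable_const)
    have hcdf : Measurable (cdf G) := (monotone_cdf G).measurable
    rw [laplace, integral_eq_lintegral_of_nonneg_ae (ae_of_all _ fun x => Real.exp_nonneg _)
      (by fun_prop), lawJ, lintegral_withDensity_eq_lintegral_mul _ (by fun_prop) (by fun_prop),
      lintegral_replacedWeight hlam]
    have h1 : ∀ y, ((fun y => ENNReal.ofReal ((qProb lam G θ)⁻¹ * lam * Real.exp (-(lam * y)) *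
        (1 - cdf G y))) * fun y => ENNReal.ofReal (Real.exp (-(s * y)))) y =
        ENNReal.ofReal (qProb lam G θ)⁻¹ *
          (ENNReal.ofReal (lam * Real.exp (-(lam * y)) * (1 - cdf G y)) *
            ENNReal.ofReal (Real.exp (-(s * y)))) := by
      intro y
      rw [Pi.mul_apply, ← mul_assoc, ← ENNReal.ofReal_mul (inv_nonneg.2 hq0)]
      congr 2
      ring
    rw [lintegral_congr h1, lintegral_const_mul _ (by fun_prop), ENNReal.toReal_mul,
      ENNReal.toReal_ofReal (by positivity), ← mul_assoc, mul_inv_cancel₀ hpos.ne', one_mul]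

end Transforms

namespace StationarySystem

variable {Ω : Type*} [MeasurableSpace Ω] {P : Measure Ω} {lam : ℝ} {G : Measure ℝ} {θ : ℝ≥0∞}
  (Q : StationarySystem P lam G θ)

/-! ### The system is idle with positive probability -/

lemma cell₁_index_le {ω : Ω} {i : ℤ} (h : (Q.X ω 0).cell₁ = some i) : i ≤ 0 := by
  have h1 := (Q.trajectory ω).arrived₁ 0 i h
  have : i < 1 := (Q.strictMono_T ω).lt_iff_lt.1 (lt_of_le_of_lt h1 (Q.T_origin ω).2)
  omega

lemma cell₂_index_le {ω : Ω} {i : ℤ} (h : (Q.X ω 0).cell₂ = some i) : i ≤ 0 := by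
  have h1 := (Q.trajectory ω).arrived₂ 0 i h
  have : i < 1 := (Q.strictMono_T ω).lt_iff_lt.1 (lt_of_le_of_lt h1 (Q.T_origin ω).2)
  omega

/-- The service time of the message in a cell, and `0` if the cell is empty. -/
def serviceTime (c : Option ℤ) (ω : Ω) : ℝ := c.elim 0 fun i => Q.σ i ω

/-- The event that the cells hold given messages at time `0`, whose remaining service time is at
most `h`. -/
def workloadLE (c₁ c₂ : Option ℤ) (h : ℝ) : Set Ω :=
  {ω | (Q.X ω 0).cell₁ = c₁} ∩ {ω | (Q.X ω 0).cell₂ = c₂} ∩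
    {ω | Q.serviceTime c₁ ω + Q.serviceTime c₂ ω - (Q.X ω 0).u ≤ h}

/-- The σ-algebra generated by the arrivals up to time `0`, their service times and the contents of
the buffer at time `0`. -/
abbrev past : MeasurableSpace Ω :=
  (⨆ n : {n : ℤ // n ≤ 0}, (MeasurableSpace.comap (Q.T n) inferInstance ⊔
      MeasurableSpace.comap (Q.σ n) inferInstance)) ⊔
    MeasurableSpace.comap (fun ω => (Q.X ω 0).u) inferInstance ⊔
    MeasurableSpace.comap (fun ω => (Q.X ω 0).cell₁) ⊤ ⊔
    MeasurableSpace.comap (fun ω => (Q.X ω 0).cell₂) ⊤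

/-- If nobody arrives before the work present at time `0` is done, the system empties. -/
lemma idle_of_workloadLE {ω : Ω} (hω : ∀ n, 0 < Q.σ n ω) {c₁ c₂ : Option ℤ} {h : ℝ} (hh : 0 ≤ h)
    (hW : ω ∈ Q.workloadLE c₁ c₂ h) (hT : h < Q.T 1 ω) : (Q.X ω h).cell₁ = none := by
  obtain ⟨⟨h1, h2⟩, h3⟩ := hW
  change (Q.X ω 0).cell₁ = c₁ at h1
  change (Q.X ω 0).cell₂ = c₂ at h2
  change Q.serviceTime c₁ ω + Q.serviceTime c₂ ω - (Q.X ω 0).u ≤ h at h3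
  rw [(Q.isRegularTrajectory hω).eq_serve_of_mem (n := 0) (Q.T_origin ω).1 hh (by simpa using hT)]
  rcases c₁ with _ | i
  · rw [Buffer.serve_of_cell₁_none _ _ h1]; rfl
  rcases c₂ with _ | j
  · rw [Buffer.serve_of_le h1 h2]
    · rfl
    · simp only [serviceTime, Option.elim] at h3
      linarith
  · have hj := hω j
    simp only [serviceTime, Option.elim] at h3
    have e1 : ¬ ((Q.X ω 0).u + (h - 0) < Q.σ i ω) := by linarith
    have e2 : ¬ ((Q.X ω 0).u + (h - 0) - Q.σ i ω < Q.σ j ω) := by linarith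
    simp only [Buffer.serve, h1, h2, e1, e2, if_false, Buffer.empty]

variable [IsProbabilityMeasure G]

lemma map_T_one (hlam : 0 < lam) : P.map (Q.T 1) = expMeasure lam := by
  rw [← Q.map_spacing hlam 1]
  congr 1
  funext ω
  exact (Q.spacing_one ω).symm

variable [IsProbabilityMeasure P]

/-- The work present at time `0` is bounded by some `h` with positive probability, independently of
whether an arrival occurs before time `h`; so the system is idle at time `h`, hence at time `0`, with
positive probability. -/
lemma idle_ne_zero (hlam : 0 < lam) (hG : ∀ᵐ x ∂G, 0 < x) :
    P {ω | (Q.X ω 0).cell₁ = none} ≠ 0 := by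
  -- some bound on the workload holds with positive probability
  obtain ⟨⟨c₁, c₂, h⟩, hpos⟩ : ∃ x : Option ℤ × Option ℤ × ℕ,
      P (Q.workloadLE x.1 x.2.1 x.2.2) ≠ 0 := by
    by_contra! hc
    have huniv : (⋃ x : Option ℤ × Option ℤ × ℕ, Q.workloadLE x.1 x.2.1 x.2.2) = univ := by
      refine eq_univ_of_forall fun ω => mem_iUnion.2 ?_
      obtain ⟨h, hh⟩ := exists_nat_ge (Q.serviceTime (Q.X ω 0).cell₁ ω +
        Q.serviceTime (Q.X ω 0).cell₂ ω - (Q.X ω 0).u)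
      exact ⟨((Q.X ω 0).cell₁, (Q.X ω 0).cell₂, h), ⟨rfl, rfl⟩, hh⟩
    have := measure_iUnion_null hc
    rw [huniv, measure_univ] at this
    exact one_ne_zero this
  simp only at hpos
  obtain ⟨ω₀, ⟨hc₁, hc₂⟩, -⟩ := nonempty_of_measure_ne_zero hpos
  have hσ : ∀ n, n ≤ 0 → Measurable[Q.past] (Q.σ n) := fun n hn =>
    Measurable.mono (comap_measurable (Q.σ n)) ((le_sup_right.trans
      (le_iSup (fun n : {n : ℤ // n ≤ 0} => (MeasurableSpace.comap (Q.T n) inferInstance ⊔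
        MeasurableSpace.comap (Q.σ n) inferInstance)) ⟨n, hn⟩)).trans
      ((le_sup_left.trans le_sup_left).trans le_sup_left)) le_rfl
  have hu : Measurable[Q.past] (fun ω => (Q.X ω 0).u) :=
    Measurable.mono (comap_measurable _) ((le_sup_right.trans le_sup_left).trans le_sup_left) le_rfl
  have hst : ∀ c : Option ℤ, (∀ i, c = some i → i ≤ 0) → Measurable[Q.past] (Q.serviceTime c) := by
    rintro (_ | i) hi
    · exact @measurable_const _ _ _ Q.past 0
    · exact hσ i (hi i rfl)
  have h₁ := hst c₁ fun i hi => Q.cell₁_index_le (hc₁.trans hi)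
  have h₂ := hst c₂ fun i hi => Q.cell₂_index_le (hc₂.trans hi)
  have hmeas : MeasurableSet[Q.past] (Q.workloadLE c₁ c₂ h) := by
    have m1 : MeasurableSet[Q.past] {ω | (Q.X ω 0).cell₁ = c₁} :=
      (le_sup_right.trans le_sup_left :
        MeasurableSpace.comap (fun ω => (Q.X ω 0).cell₁) ⊤ ≤ Q.past) _ ⟨{c₁}, trivial, rfl⟩
    have m2 : MeasurableSet[Q.past] {ω | (Q.X ω 0).cell₂ = c₂} :=
      (le_sup_right : MeasurableSpace.comap (fun ω => (Q.X ω 0).cell₂) ⊤ ≤ Q.past) _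
        ⟨{c₂}, trivial, rfl⟩
    have m3 : MeasurableSet[Q.past]
        {ω | Q.serviceTime c₁ ω + Q.serviceTime c₂ ω - (Q.X ω 0).u ≤ h} :=
      ((h₁.add h₂).sub hu) measurableSet_Iic
    exact (m1.inter m2).inter m3
  have hfut : MeasurableSet[⨆ n : {n : ℤ // 1 ≤ n}, (MeasurableSpace.comap (Q.T n) inferInstance ⊔
        MeasurableSpace.comap (Q.σ n) inferInstance)] (Q.T 1 ⁻¹' Ioi (h : ℝ)) :=
    (le_sup_left.trans (le_iSup (fun n : {n : ℤ // 1 ≤ n} =>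
      (MeasurableSpace.comap (Q.T n) inferInstance ⊔
        MeasurableSpace.comap (Q.σ n) inferInstance)) ⟨1, le_rfl⟩) :
      MeasurableSpace.comap (Q.T 1) inferInstance ≤ _) _ ⟨_, measurableSet_Ioi, rfl⟩
  have hprod := (Indep_iff _ _ _).1 Q.causal _ _ hmeas hfut
  have hT : P (Q.T 1 ⁻¹' Ioi (h : ℝ)) ≠ 0 := by
    rw [← Measure.map_apply (Q.measurable_T 1) measurableSet_Ioi, Q.map_T_one hlam,
      expMeasure_Ioi hlam (Nat.cast_nonneg h)]
    exact (ENNReal.ofReal_pos.2 (Real.exp_pos _)).ne'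
  have hstat : P {ω | (Q.X ω 0).cell₁ = none} = P {ω | (Q.X ω h).cell₁ = none} := by
    have hm : Measurable (Q.shift h) := Q.measurable_shift_comp measurable_const measurable_id
    conv_lhs => rw [← (MeasurePreserving.mk hm (Q.map_shift h)).measure_preimage
      (Q.measurableSet_cell₁_none).nullMeasurableSet]
    congr 1
    ext ω
    have := Q.cell₁_shift_eq_none h 0 ω
    rwa [zero_add] at this
  rw [hstat]
  intro hzero
  have hle : P (Q.workloadLE c₁ c₂ h ∩ Q.T 1 ⁻¹' Ioi (h : ℝ)) ≤ P {ω | (Q.X ω h).cell₁ = none} :=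
    measure_mono_ae ((Q.ae_pos_σ hlam hG).mono fun ω hω hmem =>
      Q.idle_of_workloadLE hω (Nat.cast_nonneg h) hmem.1 hmem.2)
  rw [hzero, hprod, nonpos_iff_eq_zero, mul_eq_zero] at hle
  exact hle.elim hpos hT

/-! ### The departure rate is finite -/

omit [IsProbabilityMeasure P] [IsProbabilityMeasure G] in
/-- By time `S_{3 (k + 1)}`, at least `k + 1` messages have arrived after time `0`. -/
lemma T_le_S {ω : Ω} (hω : ∀ n, 0 < Q.σ n ω) (k : ℕ) :
    Q.T (k + 1 : ℕ) ω ≤ Q.S (3 * (k + 1 : ℕ)) ω := by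
  have h := Q.isRegularTrajectory hω
  have hstep : ∀ (n : ℤ) (t : ℝ), t < Q.S (n + 1) ω → ∃ m, t < Q.T m ω ∧ Q.T m ω ≤ Q.S (n + 3) ω := by
    intro n t ht
    obtain ⟨i₁, h₁⟩ := Q.departsAt_S (n + 1) ω
    obtain ⟨i₂, h₂⟩ := Q.departsAt_S (n + 2) ω
    obtain ⟨i₃, h₃⟩ := Q.departsAt_S (n + 3) ω
    exact h.exists_arrival_of_three_departures h₁ h₂ h₃ ht
      (Q.strictMono_S ω (by omega)) (Q.strictMono_S ω (by omega))
  induction k with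
  | zero =>
    obtain ⟨m, hm, hm'⟩ := hstep 0 0 (by simpa using (Q.S_origin ω).2)
    have : 0 < m := (Q.strictMono_T ω).lt_iff_lt.1 (lt_of_le_of_lt (Q.T_origin ω).1 hm)
    exact ((Q.strictMono_T ω).monotone (by push_cast; omega)).trans
      (hm'.trans ((Q.strictMono_S ω).monotone (by simp)))
  | succ k ih =>
    obtain ⟨m, hm, hm'⟩ := hstep (3 * (k + 1 : ℕ)) (Q.S (3 * (k + 1 : ℕ)) ω)
      (Q.strictMono_S ω (by omega))
    have : ((k + 1 : ℕ) : ℤ) < m := (Q.strictMono_T ω).lt_iff_lt.1 (lt_of_le_of_lt ih hm)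
    refine ((Q.strictMono_T ω).monotone (by push_cast at *; omega)).trans
      (hm'.trans ((Q.strictMono_S ω).monotone (by push_cast; omega)))

omit [IsProbabilityMeasure P] [IsProbabilityMeasure G] in
lemma sum_spacing (ω : Ω) (k : ℕ) :
    ∑ j ∈ Finset.range k, spacing (fun m => Q.T m ω) (j + 1 : ℤ) = max (Q.T k ω) 0 := by
  induction k with
  | zero => simp [(Q.T_origin ω).1]
  | succ k ih =>
    have h1 : 0 < Q.T (k + 1) ω :=
      (Q.T_origin ω).2.trans_le ((Q.strictMono_T ω).monotone (by omega))
    rw [Finset.sum_range_succ, ih, spacing, if_pos (by omega)]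
    push_cast
    simp [max_eq_left h1.le]

omit [IsProbabilityMeasure P] in
/-- Markov's inequality for `e^{-T_k}`, where `T_k ≤ S_{3 k}`. -/
lemma measure_S_mem_le (hlam : 0 < lam) (hG : ∀ᵐ x ∂G, 0 < x) (k j : ℕ) :
    P {ω | Q.S ((3 * k + j : ℕ) + 1) ω ∈ Ioc (0 : ℝ) 1} ≤
      ENNReal.ofReal (Real.exp 1) * ENNReal.ofReal (lam / (lam + 1)) ^ k := by
  have hm : ∀ n, Measurable (fun ω => ENNReal.ofReal
      (Real.exp (-(1 * spacing (fun m => Q.T m ω) n)))) := fun n => by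
    have := Q.measurable_spacing n
    fun_prop
  have hind : iIndepFun (fun (n : ℕ) ω => ENNReal.ofReal
      (Real.exp (-(1 * spacing (fun m => Q.T m ω) (n + 1))))) P := by
    have h1 := Q.iIndep.precomp (g := fun n : ℕ => (n : ℤ) + 1) (fun a b h => by simpa using h)
    exact h1.comp (fun _ p => ENNReal.ofReal (Real.exp (-(1 * p.1)))) fun _ => by fun_prop
  have hE : ∀ n, ∫⁻ ω, ENNReal.ofReal (Real.exp (-(1 * spacing (fun m => Q.T m ω) n))) ∂P =
      ENNReal.ofReal (lam / (lam + 1)) := fun n => by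
    rw [← lintegral_exp_expMeasure hlam zero_le_one, ← Q.map_spacing hlam n,
      lintegral_map (by fun_prop) (Q.measurable_spacing n)]
  have hprod := lintegral_prod_eq_prod_lintegral_of_indepFun (Finset.range k) _ hind fun n => hm _
  simp only [hE, Finset.prod_const, Finset.card_range] at hprod
  rw [← hprod, ← lintegral_const_mul _ (Finset.measurable_prod _ fun n _ => hm _),
    ← lintegral_indicator_one (Q.measurableSet_S_mem _)]
  refine lintegral_mono_ae ((Q.ae_pos_σ hlam hG).mono fun ω hω => ?_)
  by_cases hS : ω ∈ {ω | Q.S ((3 * k + j : ℕ) + 1) ω ∈ Ioc (0 : ℝ) 1}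
  swap
  · rw [indicator_of_notMem hS]; exact zero_le
  rw [indicator_of_mem hS, Pi.one_apply,
    ← ENNReal.ofReal_prod_of_nonneg fun _ _ => Real.exp_nonneg _, ← Real.exp_sum,
    ← ENNReal.ofReal_mul (Real.exp_nonneg _), ← Real.exp_add, ENNReal.one_le_ofReal,
    Real.one_le_exp_iff]
  simp only [one_mul, Finset.sum_neg_distrib]
  rw [Q.sum_spacing, ← sub_eq_add_neg, sub_nonneg, max_le_iff]
  refine ⟨?_, zero_le_one⟩
  rcases k with _ | k
  · simpa using (Q.T_origin ω).1.trans zero_le_one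
  · refine (Q.T_le_S hω k).trans (le_trans ?_ hS.2)
    exact (Q.strictMono_S ω).monotone (by push_cast; omega)

omit [IsProbabilityMeasure P] in
lemma departureRate_ne_top (hlam : 0 < lam) (hG : ∀ᵐ x ∂G, 0 < x) : Q.departureRate ≠ ∞ := by
  have h1 : Q.departureRate = ∑' n : ℕ, P {ω | Q.S ((n : ℤ) + 1) ω ∈ Ioc (0 : ℝ) 1} := by
    rw [departureRate]
    refine (Function.Injective.tsum_eq (g := fun n : ℕ => (n : ℤ) + 1)
      (fun a b h => by simpa using h) fun n hn => ?_).symm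
    by_contra hc
    refine hn (measure_mono_null (fun ω hω => ?_) measure_empty)
    have h0 : 0 < n := (Q.strictMono_S ω).lt_iff_lt.1 (lt_of_le_of_lt (Q.S_origin ω).1 hω.1)
    exact hc ⟨(n - 1).toNat, by simp only; omega⟩
  rw [h1, ← (Nat.divModEquiv 3).symm.tsum_eq, ENNReal.tsum_prod']
  have hlt : ENNReal.ofReal (lam / (lam + 1)) < 1 := by
    rw [ENNReal.ofReal_lt_one, div_lt_one (by linarith)]
    linarith
  refine ne_top_of_le_ne_top ?_ (ENNReal.tsum_le_tsum fun k => ENNReal.tsum_le_tsum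
    (g := fun _ : Fin 3 => ENNReal.ofReal (Real.exp 1) * ENNReal.ofReal (lam / (lam + 1)) ^ k)
    fun j => ?_)
  · simp only [tsum_fintype, Finset.sum_const, Finset.card_univ, Fintype.card_fin,
      nsmul_eq_mul]
    rw [ENNReal.tsum_mul_left, ENNReal.tsum_mul_left, ENNReal.tsum_geometric]
    refine ENNReal.mul_ne_top (by simp) (ENNReal.mul_ne_top ENNReal.ofReal_ne_top ?_)
    exact ENNReal.inv_ne_top.2 (tsub_pos_of_lt hlt).ne'
  · have := Q.measure_S_mem_le hlam hG k j
    convert this using 6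
    simp [Nat.divModEquiv]
    ring

end StationarySystem

namespace StationarySystem

variable {Ω : Type*} [MeasurableSpace Ω] {P : Measure Ω} {lam : ℝ} {G : Measure ℝ} {θ : ℝ≥0∞}
  (Q : StationarySystem P lam G θ) [IsProbabilityMeasure G]

/-! ### Transforms of the cycle under the Palm measure -/

lemma ae_departureMeasure_pos_σ (hlam : 0 < lam) (hG : ∀ᵐ x ∂G, 0 < x) :
    ∀ᵐ ω ∂Q.departureMeasure, ∀ n, 0 < Q.σ n ω := by
  refine Q.ae_departureMeasure ?_ ((Q.ae_pos_σ hlam hG).mono fun ω hω n => Q.pos_shift hω _)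
  exact measurableSet_setOfPred.2 (Measurable.forall fun n =>
    measurableSet_setOfPred.1 (measurableSet_lt measurable_const (Q.measurable_σ n)))

variable [IsProbabilityMeasure P]

/-- Palm inversion applied to the idle observable. -/
lemma setLIntegral_one_sub_exp (hlam : 0 < lam) (hG : ∀ᵐ x ∂G, 0 < x) {c : ℝ} (hc : 0 < c)
    {s r : ℝ} (hsr : 0 ≤ s + r) :
    ∫⁻ ω in Q.emptyCycle, ENNReal.ofReal (1 - Real.exp (-(c * Q.idleTime ω))) *
        Q.cycleWeight s r ω ∂Q.departureMeasure =
      P {ω | (Q.X ω 0).cell₁ = none} * (ENNReal.ofReal (c * (lam / (lam + c))) *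
        ((1 - ∫⁻ p, replacedWeight θ s p ∂(G.prod (expMeasure lam)))⁻¹ *
          ENNReal.ofReal (laplace G (s + r + lam)))) := by
  have h1 : ∫⁻ t, ENNReal.ofReal (c * Real.exp (-(c * t))) ∂expMeasure lam =
      ENNReal.ofReal (c * (lam / (lam + c))) := by
    simp only [ENNReal.ofReal_mul hc.le]
    rw [lintegral_const_mul _ (by fun_prop), lintegral_exp_expMeasure hlam hc.le]
  rw [← h1, ← lintegral_servedWeight hlam hG hsr,
    ← Q.lintegral_idle_mul hlam (u := fun t => ENNReal.ofReal (c * Real.exp (-(c * t))))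
      (by fun_prop) s r,
    ← lintegral_congr_ae ((Q.ae_pos_σ hlam hG).mono fun ω hω => Q.idleObservable_eq hω c s r),
    ← Q.palm_inversion (Q.measurable_idleObservable c s r),
    ← lintegral_indicator Q.measurableSet_emptyCycle]
  refine lintegral_congr_ae ?_
  filter_upwards [Q.ae_departureMeasure_pos_σ hlam hG, Q.ae_departureMeasure_S_zero] with ω hω h0
  exact (Q.lintegral_idleObservable_shift hω h0 hc s r).symm

/-- The limit `c → ∞` of `setLIntegral_one_sub_exp`, by monotone convergence: the idle time is
positive. -/
lemma setLIntegral_cycleWeight (hlam : 0 < lam) (hG : ∀ᵐ x ∂G, 0 < x) {s r : ℝ}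
    (hs : 0 ≤ s) (hsr : 0 ≤ s + r) :
    ∫⁻ ω in Q.emptyCycle, Q.cycleWeight s r ω ∂Q.departureMeasure =
      P {ω | (Q.X ω 0).cell₁ = none} * (ENNReal.ofReal lam *
        ((1 - ∫⁻ p, replacedWeight θ s p ∂(G.prod (expMeasure lam)))⁻¹ *
          ENNReal.ofReal (laplace G (s + r + lam)))) := by
  have hmI := Q.measurable_idleTime
  have hmW := Q.measurable_cycleWeight s r
  have hlim1 : Tendsto (fun n : ℕ => ∫⁻ ω in Q.emptyCycle,
      ENNReal.ofReal (1 - Real.exp (-(((n : ℝ) + 1) * Q.idleTime ω))) * Q.cycleWeight s r ω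
        ∂Q.departureMeasure) atTop
      (nhds (∫⁻ ω in Q.emptyCycle, Q.cycleWeight s r ω ∂Q.departureMeasure)) := by
    refine lintegral_tendsto_of_tendsto_of_monotone (fun n => by fun_prop)
      (ae_of_all _ fun ω m n hmn => ?_) (ae_of_all _ fun ω => ?_)
    · have hI := Q.idleTime_pos ω
      have hmn' : (m : ℝ) ≤ n := by exact_mod_cast hmn
      refine mul_le_mul' (ENNReal.ofReal_le_ofReal ?_) le_rfl
      have := Real.exp_le_exp.2 (neg_le_neg (mul_le_mul_of_nonneg_right
        (add_le_add_left hmn' 1) hI.le))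
      linarith
    · have hI := Q.idleTime_pos ω
      have h1 : Tendsto (fun n : ℕ => ((n : ℝ) + 1) * Q.idleTime ω) atTop atTop :=
        (tendsto_natCast_atTop_atTop.atTop_add tendsto_const_nhds).atTop_mul_const hI
      have h2 := (ENNReal.continuous_ofReal.tendsto _).comp
        ((Real.tendsto_exp_neg_atTop_nhds_zero.comp h1).const_sub 1)
      have h3 := ENNReal.Tendsto.mul_const (b := Q.cycleWeight s r ω) h2
        (Or.inr (by unfold cycleWeight; exact ENNReal.ofReal_ne_top))
      simpa using h3
  have hlim2 : Tendsto (fun n : ℕ => P {ω | (Q.X ω 0).cell₁ = none} *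
      (ENNReal.ofReal (((n : ℝ) + 1) * (lam / (lam + ((n : ℝ) + 1)))) *
        ((1 - ∫⁻ p, replacedWeight θ s p ∂(G.prod (expMeasure lam)))⁻¹ *
          ENNReal.ofReal (laplace G (s + r + lam))))) atTop
      (nhds (P {ω | (Q.X ω 0).cell₁ = none} * (ENNReal.ofReal lam *
        ((1 - ∫⁻ p, replacedWeight θ s p ∂(G.prod (expMeasure lam)))⁻¹ *
          ENNReal.ofReal (laplace G (s + r + lam)))))) := by
    have hne : (1 - ∫⁻ p, replacedWeight θ s p ∂(G.prod (expMeasure lam)))⁻¹ *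
          ENNReal.ofReal (laplace G (s + r + lam)) ≠ ∞ :=
      ENNReal.mul_ne_top (ENNReal.inv_ne_top.2
        (tsub_pos_of_lt (lintegral_replacedWeight_lt_one hlam hG θ hs)).ne') ENNReal.ofReal_ne_top
    refine ENNReal.Tendsto.const_mul (ENNReal.Tendsto.mul_const ?_ (Or.inr hne))
      (Or.inr (measure_ne_top _ _))
    refine (ENNReal.continuous_ofReal.tendsto _).comp ?_
    have h1 : Tendsto (fun n : ℕ => lam + ((n : ℝ) + 1)) atTop atTop :=
      tendsto_atTop_add_const_left _ _
        (tendsto_natCast_atTop_atTop.atTop_add tendsto_const_nhds)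
    have h2 : Tendsto (fun n : ℕ => lam - lam * lam * (lam + ((n : ℝ) + 1))⁻¹) atTop
        (nhds (lam - lam * lam * 0)) :=
      ((tendsto_inv_atTop_zero.comp h1).const_mul _).const_sub _
    rw [mul_zero, sub_zero] at h2
    refine h2.congr fun n => ?_
    have : lam + ((n : ℝ) + 1) ≠ 0 := by positivity
    field_simp
    ring
  refine tendsto_nhds_unique hlim1 (hlim2.congr fun n => ?_)
  rw [Q.setLIntegral_one_sub_exp hlam hG (by positivity) hsr]

lemma inv_one_sub_replacedWeight (hlam : 0 < lam) (hG : ∀ᵐ x ∂G, 0 < x) (θ : ℝ≥0∞) {s : ℝ}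
    (hs : 0 ≤ s) : qProb lam G θ * laplace (lawJ lam G θ) s < 1 ∧
      (1 - ∫⁻ p, replacedWeight θ s p ∂(G.prod (expMeasure lam)))⁻¹ =
        ENNReal.ofReal (1 - qProb lam G θ * laplace (lawJ lam G θ) s)⁻¹ := by
  have hlt := lintegral_replacedWeight_lt_one hlam hG θ hs
  rw [qProb_mul_laplace_lawJ hlam hG θ hs]
  have h1 : (∫⁻ p, replacedWeight θ s p ∂(G.prod (expMeasure lam))).toReal < 1 := by
    rw [← ENNReal.toReal_one]
    exact (ENNReal.toReal_lt_toReal hlt.ne_top ENNReal.one_ne_top).2 hlt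
  refine ⟨h1, ?_⟩
  rw [ENNReal.ofReal_inv_of_pos (by linarith), ENNReal.ofReal_sub _ ENNReal.toReal_nonneg,
    ENNReal.ofReal_one, ENNReal.ofReal_toReal hlt.ne_top]

/-- The transform `∫ e^{-s x - r y}` of a cycle, without its idle period. -/
noncomputable def cycleTransform (Q : StationarySystem P lam G θ) (s r : ℝ) : ℝ :=
  P.real {ω | (Q.X ω 0).cell₁ = none} * lam *
    ((1 - qProb lam G θ * laplace (lawJ lam G θ) s)⁻¹ * laplace G (s + r + lam))

lemma cycleTransform_pos (hlam : 0 < lam) (hG : ∀ᵐ x ∂G, 0 < x) {s r : ℝ} (hs : 0 ≤ s)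
    (hsr : 0 ≤ s + r) : 0 < Q.cycleTransform s r := by
  have h1 := (inv_one_sub_replacedWeight hlam hG θ hs).1
  have h2 : 0 < (1 - qProb lam G θ * laplace (lawJ lam G θ) s)⁻¹ := inv_pos.2 (by linarith)
  have h3 : 0 < laplace G (s + r + lam) := laplace_pos hG (by linarith)
  have h4 : 0 < P.real {ω | (Q.X ω 0).cell₁ = none} :=
    ENNReal.toReal_pos (Q.idle_ne_zero hlam hG) (measure_ne_top _ _)
  unfold cycleTransform
  positivity

lemma setLIntegral_cycleWeight_eq (hlam : 0 < lam) (hG : ∀ᵐ x ∂G, 0 < x) {s r : ℝ}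
    (hs : 0 ≤ s) (hsr : 0 ≤ s + r) :
    ∫⁻ ω in Q.emptyCycle, Q.cycleWeight s r ω ∂Q.departureMeasure =
      ENNReal.ofReal (Q.cycleTransform s r) := by
  obtain ⟨h1, h2⟩ := inv_one_sub_replacedWeight hlam hG θ hs
  rw [Q.setLIntegral_cycleWeight hlam hG hs hsr, h2, cycleTransform,
    ENNReal.ofReal_mul (by positivity), ENNReal.ofReal_mul (by positivity),
    ENNReal.ofReal_mul (inv_nonneg.2 (by linarith)), ofReal_measureReal, mul_assoc]

/-- The idle period is exponential, and independent of the rest of the cycle. -/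
lemma setLIntegral_exp_mul_cycleWeight (hlam : 0 < lam) (hG : ∀ᵐ x ∂G, 0 < x) {c s r : ℝ}
    (hc : 0 ≤ c) (hs : 0 ≤ s) (hsr : 0 ≤ s + r) :
    ∫⁻ ω in Q.emptyCycle, ENNReal.ofReal (Real.exp (-(c * Q.idleTime ω))) *
        Q.cycleWeight s r ω ∂Q.departureMeasure =
      ENNReal.ofReal (lam / (lam + c) * Q.cycleTransform s r) := by
  have hD := Q.setLIntegral_cycleWeight_eq hlam hG hs hsr
  rcases hc.eq_or_lt with rfl | hc
  · simp [hD, div_self hlam.ne']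
  have hmI := Q.measurable_idleTime
  have hmW := Q.measurable_cycleWeight s r
  have hpos := Q.cycleTransform_pos hlam hG hs hsr
  obtain ⟨h1, h2⟩ := inv_one_sub_replacedWeight hlam hG θ hs
  have hX : ∫⁻ ω in Q.emptyCycle, ENNReal.ofReal (1 - Real.exp (-(c * Q.idleTime ω))) *
        Q.cycleWeight s r ω ∂Q.departureMeasure =
      ENNReal.ofReal (c / (lam + c) * Q.cycleTransform s r) := by
    have e : c / (lam + c) * Q.cycleTransform s r = P.real {ω | (Q.X ω 0).cell₁ = none} *
        (c * (lam / (lam + c)) * ((1 - qProb lam G θ * laplace (lawJ lam G θ) s)⁻¹ *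
          laplace G (s + r + lam))) := by
      unfold cycleTransform
      ring
    rw [Q.setLIntegral_one_sub_exp hlam hG hc hsr, h2, e,
      ENNReal.ofReal_mul (p := P.real _) (by positivity),
      ENNReal.ofReal_mul (p := c * (lam / (lam + c))) (by positivity),
      ENNReal.ofReal_mul (inv_nonneg.2 (by linarith)), ofReal_measureReal]
  have hsum : ∫⁻ ω in Q.emptyCycle, ENNReal.ofReal (1 - Real.exp (-(c * Q.idleTime ω))) *
        Q.cycleWeight s r ω ∂Q.departureMeasure +
      ∫⁻ ω in Q.emptyCycle, ENNReal.ofReal (Real.exp (-(c * Q.idleTime ω))) *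
        Q.cycleWeight s r ω ∂Q.departureMeasure = ENNReal.ofReal (Q.cycleTransform s r) := by
    rw [← lintegral_add_left (by fun_prop), ← hD]
    refine lintegral_congr fun ω => ?_
    have hle : Real.exp (-(c * Q.idleTime ω)) ≤ 1 := by
      rw [Real.exp_le_one_iff]
      have := mul_pos hc (Q.idleTime_pos ω)
      linarith
    rw [← add_mul, ← ENNReal.ofReal_add (by linarith) (Real.exp_nonneg _), sub_add_cancel,
      ENNReal.ofReal_one, one_mul]
  rw [hX] at hsum
  have hsplit : Q.cycleTransform s r =
      c / (lam + c) * Q.cycleTransform s r + lam / (lam + c) * Q.cycleTransform s r := by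
    have : lam + c ≠ 0 := by positivity
    field_simp
    ring
  conv_rhs at hsum => rw [hsplit, ENNReal.ofReal_add (by positivity) (by positivity)]
  exact (ENNReal.add_right_inj ENNReal.ofReal_ne_top).1 hsum

/-! ### The conditional Palm probability -/

lemma departureMeasure_emptyCycle (hlam : 0 < lam) (hG : ∀ᵐ x ∂G, 0 < x) :
    Q.departureMeasure Q.emptyCycle = ENNReal.ofReal (Q.cycleTransform 0 0) := by
  rw [← Q.setLIntegral_cycleWeight_eq hlam hG le_rfl (by simp)]
  simp [cycleWeight]

/-- The normalisation by the departure rate cancels in the conditional Palm probability. -/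
lemma lintegral_palmCond (hlam : 0 < lam) (hG : ∀ᵐ x ∂G, 0 < x) (F : Ω → ℝ≥0∞) :
    ∫⁻ ω, F ω ∂Q.palmCond 0 0 = (ENNReal.ofReal (Q.cycleTransform 0 0))⁻¹ *
      ∫⁻ ω in Q.emptyCycle, F ω ∂Q.departureMeasure := by
  have hA := Q.departureMeasure_emptyCycle hlam hG
  have hpos := ENNReal.ofReal_pos.2 (Q.cycleTransform_pos hlam hG le_rfl
    (show (0 : ℝ) ≤ 0 + 0 by simp))
  have hr0 : Q.departureRate ≠ 0 := by
    rw [← departureMeasure_univ]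
    refine fun h => hpos.ne' ?_
    rw [← hA]
    exact measure_mono_null (subset_univ _) h
  have hrt := Q.departureRate_ne_top hlam hG
  have hdef : Q.palmCond 0 0 = ProbabilityTheory.cond Q.palm Q.emptyCycle := rfl
  rw [hdef, ProbabilityTheory.cond, lintegral_smul_measure, palm_eq, Measure.restrict_smul,
    lintegral_smul_measure, Measure.smul_apply, hA, smul_eq_mul, smul_eq_mul, smul_eq_mul,
    ENNReal.mul_inv (Or.inr ENNReal.ofReal_ne_top) (Or.inr hpos.ne'), inv_inv,
    mul_mul_mul_comm, ENNReal.mul_inv_cancel hr0 hrt, one_mul]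

omit [IsProbabilityMeasure G] [IsProbabilityMeasure P] in
lemma ae_palmCond {p : Ω → Prop} (hp : ∀ᵐ ω ∂Q.departureMeasure, ω ∈ Q.emptyCycle → p ω) :
    ∀ᵐ ω ∂Q.palmCond 0 0, p ω := by
  have hdef : Q.palmCond 0 0 = ProbabilityTheory.cond Q.palm Q.emptyCycle := rfl
  rw [hdef, ProbabilityTheory.cond, palm_eq, Measure.restrict_smul]
  exact Measure.ae_smul_measure (Measure.ae_smul_measure
    ((ae_restrict_iff' Q.measurableSet_emptyCycle).2 hp) _) _

end StationarySystem

/-! ### The age of information at a departure -/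

/-- If the system is empty at time `a` and after the next departure at time `d`, the departing
message is the last one that arrived: a later arrival would still be present. -/
lemma IsRegularTrajectory.departing_message_eq {θ : ℝ≥0∞} {T σ : ℤ → ℝ} {X : ℝ → Buffer}
    (h : IsRegularTrajectory θ T σ X) {a d : ℝ} {i n : ℤ} (had : a < d) (ha : (X a).cell₁ = none)
    (hd : DepartsAt σ X i d) (hXd : (X d).cell₁ = none)
    (hno : ∀ j t, DepartsAt σ X j t → a < t → d ≤ t) (hn : T n ≤ d) (hn' : d < T (n + 1)) :
    i = n := by
  have hnd : T n < d := lt_of_le_of_ne hn fun hc => h.arrival_cell₁ n (hc ▸ hXd)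
  have han : a < T n := by
    by_contra hc
    obtain ⟨r, hr, hrd, hi, -⟩ := h.exists_before_departure hd had
    have : (X r).cell₁ = none := by
      refine h.empty_of_empty hr ha fun m hm => ?_
      have e1 : n < m := h.strictMono.lt_iff_lt.1 (by linarith [hm.1])
      have e2 : m < n + 1 := h.strictMono.lt_iff_lt.1 (by linarith [hm.2])
      omega
    simp [this] at hi
  obtain ⟨r, hr, hrd, hi, -⟩ := h.exists_before_departure hd hnd
  obtain ⟨j, hj⟩ := Option.ne_none_iff_exists'.1 (h.arrival_cell₁ n)
  have hu := h.u_lt hj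
  -- the service in progress at time `T n` is not completed before time `d`
  have hle : d ≤ T n + (σ j - (X (T n)).u) := by
    by_contra hc
    refine hc (hno j _ (h.departsAt hj rfl fun m hm => ?_) (by linarith))
    have e1 : n < m := h.strictMono.lt_iff_lt.1 hm.1
    have e2 : m < n + 1 := h.strictMono.lt_iff_lt.1 (by linarith [hm.2])
    omega
  have hXr := h.eq_serve_of_mem le_rfl hr (hrd.trans hn')
  rw [Buffer.serve_of_lt hj (by linarith)] at hXr
  have hij : i = j := by
    rw [hXr] at hi
    simpa using hi.symm
  rw [hij]
  have harr := h.traj.arrive (n - 1)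
  rw [sub_add_cancel] at harr
  unfold Buffer.arrive at harr
  split_ifs at harr with hθ
  · rw [harr] at hj
    simpa using hj.symm
  · -- message `n` waits, and is in service at time `d`
    have hc₂ : (X (T n)).cell₂ = some n := by rw [harr]
    rw [h.eq_serve_of_mem le_rfl hn hn'] at hXd
    by_cases hlt : (X (T n)).u + (d - T n) < σ j
    · rw [Buffer.serve_of_lt hj hlt] at hXd
      simp at hXd
    · have e : (X (T n)).u + (d - T n) - σ j < σ n := by linarith [h.pos n]
      simp [Buffer.serve, hj, hc₂, hlt, e] at hXd

namespace StationarySystem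

variable {Ω : Type*} [MeasurableSpace Ω] {P : Measure Ω} {lam : ℝ} {G : Measure ℝ} {θ : ℝ≥0∞}
  (Q : StationarySystem P lam G θ)

/-- At the end of a cycle, the most recent message has just been served. -/
lemma age_eq_of_emptyCycle {ω : Ω} (hω : ∀ n, 0 < Q.σ n ω) (h0 : Q.S 0 ω = 0)
    (hA : ω ∈ Q.emptyCycle) : Q.α ω (Q.S 0 ω) = Q.S 0 ω - Q.T 0 ω := by
  have h := Q.isRegularTrajectory hω
  obtain ⟨hT0, hT1⟩ := Q.T_origin ω
  obtain ⟨i, hi⟩ := Q.departsAt_S 0 ω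
  have hi0 : i = 0 := h.departing_message_eq (a := Q.S (-1) ω) (n := 0)
    (Q.strictMono_S ω (by omega)) ((Q.K_eq_zero_iff hω _).1 hA.1) hi
    ((Q.K_eq_zero_iff hω _).1 hA.2) (fun j t ht hat => Q.S_zero_le_of_departsAt ht hat)
    (hT0.trans_eq h0.symm) (by simpa [h0] using hT1)
  subst hi0
  rw [α, age, lastServedArrival]
  congr 1
  refine IsGreatest.csSup_eq ⟨⟨0, _, hi, le_rfl, rfl⟩, ?_⟩
  rintro _ ⟨j, d, hd, hd', rfl⟩
  have hjd := h.arrival_lt_departure hd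
  have : j < 1 := (Q.strictMono_T ω).lt_iff_lt.1 (by linarith)
  exact (Q.strictMono_T ω).monotone (by omega)

variable [IsProbabilityMeasure P] [IsProbabilityMeasure G]

lemma integral_palmCond (hlam : 0 < lam) (hG : ∀ᵐ x ∂G, 0 < x) {f : Ω → ℝ} (hf : Measurable f)
    (hf0 : ∀ ω, 0 ≤ f ω) {x : ℝ} (hx : 0 ≤ x)
    (h : ∫⁻ ω in Q.emptyCycle, ENNReal.ofReal (f ω) ∂Q.departureMeasure = ENNReal.ofReal x) :
    ∫ ω, f ω ∂Q.palmCond 0 0 = (Q.cycleTransform 0 0)⁻¹ * x := by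
  have hpos := Q.cycleTransform_pos hlam hG le_rfl (show (0 : ℝ) ≤ 0 + 0 by simp)
  rw [integral_eq_lintegral_of_nonneg_ae (ae_of_all _ hf0) hf.aestronglyMeasurable,
    Q.lintegral_palmCond hlam hG, h, ← ENNReal.ofReal_inv_of_pos hpos,
    ← ENNReal.ofReal_mul (inv_nonneg.2 hpos.le), ENNReal.toReal_ofReal (by positivity)]

end StationarySystem

end AoI

theorem mainTheorem2 {Ω : Type*} [MeasurableSpace Ω] (P : Measure Ω) [IsProbabilityMeasure P]
    (lam : ℝ) (hlam : 0 < lam)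
    (G : Measure ℝ) [IsProbabilityMeasure G] (hG : ∀ᵐ x ∂G, 0 < x) (hmean : Integrable id G)
    (θ : ℝ≥0∞) (Q : AoI.StationarySystem P lam G θ) (s : ℝ) (hs : 0 ≤ s) :
    (∫ ω, Real.exp (-(s * (Q.S 0 ω - Q.S (-1) ω))) ∂(Q.palmCond 0 0) =
      lam / (lam + s) *
        ((1 - AoI.qProb lam G θ) /
          (1 - AoI.qProb lam G θ * AoI.laplace (AoI.lawJ lam G θ) s)) *
        AoI.F₀hat lam G s) ∧
    (∫ ω, Real.exp (-(s * Q.α ω (Q.S 0 ω))) ∂(Q.palmCond 0 0) = AoI.F₀hat lam G s) := by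
  have hidle : P.real {ω | (Q.X ω 0).cell₁ = none} ≠ 0 :=
    (ENNReal.toReal_pos (Q.idle_ne_zero hlam hG) (measure_ne_top _ _)).ne'
  have hq0 : AoI.qProb lam G θ * AoI.laplace (AoI.lawJ lam G θ) 0 = AoI.qProb lam G θ := by
    rw [AoI.qProb_mul_laplace_lawJ hlam hG θ le_rfl, AoI.qProb_eq hlam hG θ]
  have hq1 := (AoI.StationarySystem.inv_one_sub_replacedWeight hlam hG θ le_rfl).1
  have hqs := (AoI.StationarySystem.inv_one_sub_replacedWeight hlam hG θ hs).1
  rw [hq0] at hq1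
  have hq1' : 1 - AoI.qProb lam G θ ≠ 0 := by linarith
  have hqs' : 1 - AoI.qProb lam G θ * AoI.laplace (AoI.lawJ lam G θ) s ≠ 0 := by linarith
  have hG0 : AoI.laplace G lam ≠ 0 := (AoI.laplace_pos hG hlam.le).ne'
  have hls : lam + s ≠ 0 := by positivity
  have hS0 := Q.measurable_S 0
  have hS1 := Q.measurable_S (-1)
  have hT0 := Q.measurable_T 0
  constructor
  · have hpos := Q.cycleTransform_pos hlam hG hs (show 0 ≤ s + 0 by linarith)
    rw [Q.integral_palmCond hlam hG (x := lam / (lam + s) * Q.cycleTransform s 0) (by fun_prop)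
      (fun ω => Real.exp_nonneg _) (by positivity)]
    · rw [AoI.StationarySystem.cycleTransform, AoI.StationarySystem.cycleTransform, hq0, add_zero,
        add_zero, zero_add, AoI.F₀hat]
      field_simp
    · rw [← Q.setLIntegral_exp_mul_cycleWeight hlam hG hs hs (by linarith)]
      refine lintegral_congr fun ω => ?_
      rw [AoI.StationarySystem.cycleWeight, ← ENNReal.ofReal_mul (Real.exp_nonneg _),
        ← Real.exp_add]
      congr 2
      ring
  · have hage : ∀ᵐ ω ∂Q.palmCond 0 0, Real.exp (-(s * Q.α ω (Q.S 0 ω))) =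
        Real.exp (-(s * (Q.S 0 ω - Q.T 0 ω))) := by
      refine Q.ae_palmCond ?_
      filter_upwards [Q.ae_departureMeasure_pos_σ hlam hG, Q.ae_departureMeasure_S_zero]
        with ω hω h0 hA
      rw [Q.age_eq_of_emptyCycle hω h0 hA]
    have hpos := Q.cycleTransform_pos hlam hG le_rfl (show 0 ≤ 0 + s by linarith)
    rw [integral_congr_ae hage, Q.integral_palmCond hlam hG (x := Q.cycleTransform 0 s)
      (by fun_prop) (fun ω => Real.exp_nonneg _) hpos.le]
    · rw [AoI.StationarySystem.cycleTransform, AoI.StationarySystem.cycleTransform, hq0, add_zero,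
        zero_add, zero_add, AoI.F₀hat]
      field_simp
    · rw [← Q.setLIntegral_cycleWeight_eq hlam hG le_rfl (by linarith)]
      refine lintegral_congr fun ω => ?_
      rw [AoI.StationarySystem.cycleWeight]
      congr 2
      ring
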